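/- Let $\Bbbk$ be an algebraically closed field of characteristic zero and let $H$ be a finite-dimensional factorizable ribbon Hopf algebra over $\Bbbk$, with antipode $S$, R-matrix $R$, ribbon element $v$, monodromy matrix $Q=R_{21}R$, Drinfeld element $u=m(S\otimes\mathrm{id})(R_{21})$ and $t=uv^{-1}$. Chiral side. In the ribbon category of finite-dimensional left $H$-modules (braiding $c_{U,V}(x\otimes y)=\tau(R\,(x\otimes y))$, sovereign structure $\pi_V(\varphi)=\varphi(t\,\cdot)$), let $L=\int^U U^\vee\otimes U$. Explicitly, $L=H^*$ with the coadjoint action and dinatural family $i_U(\varphi\otimes x)=(h\mapsto\varphi(hx))$. It is a Hopf algebra in this category, with counit given by $\varepsilon_L\circ i_U=d_U$ (evaluation) and antipode given by $S_L\circ i_U=(d_U\otimes i_{U^\vee})\circ(\mathrm{id}\otimes c_{U^{\vee\vee},U}\otimes\mathrm{id})\circ(b_{U^\vee}\otimes c_{U^\vee,U})$ ($b$ the coevaluation). Every $H$-module $V$ is an $L$-module $(V,\rho^L_V)$ with action $\rho^L_V=(\varepsilon_L\otimes\mathrm{id}_V)\circ\mathcal Q_{L,V}$, where the partial monodromy $\mathcal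 Q_{L,V}\in\mathrm{End}(L\otimes V)$ is determined by $\mathcal Q_{L,V}\circ(i_U\otimes\mathrm{id}_V)=(i_U\otimes\mathrm{id}_V)\circ(\mathrm{id}_{U^\vee}\otimes c_{V,U}c_{U,V})$. The character of an $L$-module $(V,\rho)$ is the linear form $f\mapsto\mathrm{tr}_V(t\,\rho(f\otimes\cdot\,))$ on $L$. Bulk side. In the category of finite-dimensional $H$-bimodules with braiding $x\otimes y\mapsto\tau(R_{21}^{-1}\,(x\otimes y)\,R_{21})$ and sovereign structure $\varphi\mapsto\varphi(t\,\cdot\,t)$, let $K=\int^X X^\vee\otimes X$. Its underlying vector space is $H^*\otimes H^*=L\otimes L$, with $i^K_X(\varphi\otimes x)=(h\otimes h'\mapsto\varphi(h\,x\,h'))$. Define the canonical $K$-action $\rho^K_X$ on a bimodule $X$ by partial monodromy as above, and its character $\chi^K_X$ as the trace of this action composed with $x\mapsto t\,x\,t$; it is a linear form on $K$. Let $(S_i)_{i\in I}$ be a full set of representatives of the (finitely many) isomorphism classes of simple left $H$-modules. Let $\chi^L_j$ be the character of the $L$-module $(S_j,\rho^L_{S_j})$, and let $\chi^L_{\overline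 i}$ be the character of the $L$-module dual to $(S_i,\rho^L_{S_i})$ (the module $S_i^\vee$ with action defined through the antipode $S_L$). Proposition. For every finite-dimensional $H$-bimodule $X$, regarded as the $K$-module $(X,\rho^K_X)$, $$\chi^K_X=\sum_{i,j\in I} n_{i,j}\,\chi^L_{\overline i}\otimes\chi^L_j ,$$ where $n_{i,j}\in\mathbb Z_{\ge0}$ is the Jordan–Hölder multiplicity in $X$ of the simple $H\otimes H^{\mathrm{op}}$-module $S_i\otimes_\Bbbk S_j^*$; here $S_j^*$ is the linear dual with right action $(\varphi h)(s)=\varphi(hs)$. -/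

import Mathlib

open scoped TensorProduct

universe u

namespace BulkCharacter

noncomputable section

/-! ## Jordan–Hölder multiplicities -/

section JordanHolder

variable (A : Type*) [Ring A] {X : Type*} [AddCommGroup X] [Module A X]
variable (Y : Type*) [AddCommGroup Y] [Module A Y]

/-- The `m`-th subquotient of the composition series `s` is isomorphic to `Y`. -/
def FactorIso (s : CompositionSeries (Submodule A X)) (m : Fin s.length) : Prop :=
  Nonempty ((s m.succ ⧸ (s m.castSucc).submoduleOf (s m.succ)) ≃ₗ[A] Y)

/-- The number of subquotients of the composition series `s` that are isomorphic to `Y`. -/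
def factorCount (s : CompositionSeries (Submodule A X)) : ℕ :=
  Nat.card {m : Fin s.length // FactorIso A Y s m}

variable (X) in
open Classical in
/-- The Jordan–Hölder multiplicity `[X : Y]`, read off from a composition series of `X`
(which exists for `X` of finite length; which one is taken does not matter,
see `jhMultiplicity_eq`). -/
def jhMultiplicity : ℕ :=
  if h : ∃ s : CompositionSeries (Submodule A X), s.head = ⊥ ∧ s.last = ⊤ then
    factorCount A Y h.choose
  else 0

theorem exists_jhSeries [IsNoetherian A X] [IsArtinian A X] :
    ∃ s : CompositionSeries (Submodule A X), s.head = ⊥ ∧ s.last = ⊤ :=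
  exists_compositionSeries_of_isNoetherian_isArtinian A X

theorem factorCount_eq_of_series (s s' : CompositionSeries (Submodule A X))
    (h0 : s.head = s'.head) (h1 : s.last = s'.last) :
    factorCount A Y s = factorCount A Y s' := by
  obtain ⟨f, hf⟩ := CompositionSeries.jordan_holder s s' h0 h1
  have key : ∀ m, Nonempty ((s m.succ ⧸ (s m.castSucc).submoduleOf (s m.succ)) ≃ₗ[A]
      (s' (f m).succ ⧸ (s' (f m).castSucc).submoduleOf (s' (f m).succ))) := fun m =>
    JordanHolderLattice.Iso.rel
      (fun p q : Submodule A X × Submodule A X =>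
        Nonempty ((p.2 ⧸ p.1.submoduleOf p.2) ≃ₗ[A] (q.2 ⧸ q.1.submoduleOf q.2)))
      ⟨LinearEquiv.refl _ _⟩ (fun ⟨e⟩ => ⟨e.symm⟩) (fun ⟨e⟩ ⟨e'⟩ => ⟨e.trans e'⟩)
      (by
        intro x y _
        have e := LinearMap.quotientInfEquivSupQuotient y x
        rw [inf_comm, sup_comm] at e
        exact ⟨e.symm⟩)
      (hf m)
  refine Nat.card_congr (f.subtypeEquiv fun m => ?_)
  obtain ⟨e⟩ := key m
  exact ⟨fun ⟨g⟩ => ⟨e.symm.trans g⟩, fun ⟨g⟩ => ⟨e.trans g⟩⟩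

theorem jhMultiplicity_eq (s : CompositionSeries (Submodule A X))
    (h0 : s.head = ⊥) (h1 : s.last = ⊤) :
    jhMultiplicity A X Y = factorCount A Y s := by
  have h : ∃ s : CompositionSeries (Submodule A X), s.head = ⊥ ∧ s.last = ⊤ := ⟨s, h0, h1⟩
  rw [jhMultiplicity, dif_pos h]
  exact factorCount_eq_of_series A Y _ _ (h.choose_spec.1.trans h0.symm)
    (h.choose_spec.2.trans h1.symm)

end JordanHolder

/-! ## The coend `∫^U U^∨ ⊗ U` and partial monodromy

A finite-dimensional module over the algebra `A` is a finite-dimensional vector space `U` with an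
algebra homomorphism `ρ : A → End U`. The vector space underlying the coend of
`(U, V) ↦ U^∨ ⊗ V` is `A^*`, with `i_U (φ ⊗ u) = (a ↦ φ (a u))`. -/

section Coend

variable {k A : Type*} [Field k] [Ring A] [Algebra k A]
variable {U V : Type*} [AddCommGroup U] [Module k U] [AddCommGroup V] [Module k V]

/-- The dinatural morphism `i_U : U^∨ ⊗ U → A^*`. -/
def coendIncl (ρ : A →ₐ[k] Module.End k U) :
    Module.Dual k U ⊗[k] U →ₗ[k] Module.Dual k A :=
  TensorProduct.lift (LinearMap.mk₂ k (fun φ u => φ ∘ₗ ρ.toLinearMap.flip u)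
    (by intros; ext; simp) (by intros; ext; simp) (by intros; ext; simp) (by intros; ext; simp))

@[simp]
theorem coendIncl_tmul (ρ : A →ₐ[k] Module.End k U) (φ : Module.Dual k U) (u : U) (a : A) :
    coendIncl ρ (φ ⊗ₜ u) a = φ (ρ a u) := rfl

/-- The regular left module. -/
def regRep (k A : Type*) [Field k] [Ring A] [Algebra k A] : A →ₐ[k] Module.End k A :=
  Algebra.lmul k A

@[simp]
theorem regRep_apply (a b : A) : regRep k A a b = a * b := rfl

theorem coendIncl_dinatural (ρ : A →ₐ[k] Module.End k U) (σ : A →ₐ[k] Module.End k V)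
    (f : U →ₗ[k] V) (hf : ∀ a, f ∘ₗ ρ a = σ a ∘ₗ f) (ψ : Module.Dual k V) (u : U) :
    coendIncl ρ ((ψ ∘ₗ f) ⊗ₜ u) = coendIncl σ (ψ ⊗ₜ f u) := by
  ext a
  simpa using congrArg ψ (LinearMap.congr_fun (hf a) u)

/-- The universal property of the coend. -/
theorem coendIncl_universal {k A : Type u} [Field k] [Ring A] [Algebra k A]
    [FiniteDimensional k A] {B : Type u} [AddCommGroup B] [Module k B]
    (F : ∀ (U : Type u) [AddCommGroup U] [Module k U] [FiniteDimensional k U],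
      (A →ₐ[k] Module.End k U) → (Module.Dual k U ⊗[k] U →ₗ[k] B))
    (hF : ∀ (U V : Type u) [AddCommGroup U] [Module k U] [FiniteDimensional k U]
      [AddCommGroup V] [Module k V] [FiniteDimensional k V]
      (ρ : A →ₐ[k] Module.End k U) (σ : A →ₐ[k] Module.End k V) (f : U →ₗ[k] V),
      (∀ a, f ∘ₗ ρ a = σ a ∘ₗ f) → ∀ (ψ : Module.Dual k V) (u : U),
        F U ρ ((ψ ∘ₗ f) ⊗ₜ u) = F V σ (ψ ⊗ₜ f u)) :
    ∃! κ : Module.Dual k A →ₗ[k] B,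
      ∀ (U : Type u) [AddCommGroup U] [Module k U] [FiniteDimensional k U]
        (ρ : A →ₐ[k] Module.End k U), κ ∘ₗ coendIncl ρ = F U ρ := by
  refine ⟨F A (regRep k A) ∘ₗ (TensorProduct.mk k (Module.Dual k A) A).flip 1, ?_, ?_⟩
  · intro U _ _ _ ρ
    ext φ u
    have := hF A U (regRep k A) ρ (ρ.toLinearMap.flip u) (by intro a; ext b; simp) φ 1
    exact this.trans (by simp)
  · intro κ hκ
    ext f
    have := LinearMap.congr_fun (hκ A (regRep k A)) (f ⊗ₜ 1)
    simp only [LinearMap.comp_apply] at this ⊢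
    simp only [LinearMap.flip_apply, TensorProduct.mk_apply]
    rw [← this]
    congr 1
    ext a
    simp

/-- The braiding `c_{U,V} : U ⊗ V → V ⊗ U`, `u ⊗ v ↦ τ (P · (u ⊗ v))`, determined by an element
`P ∈ A ⊗ A`. -/
def braiding (P : A ⊗[k] A) (ρ : A →ₐ[k] Module.End k U) (σ : A →ₐ[k] Module.End k V) :
    U ⊗[k] V →ₗ[k] V ⊗[k] U :=
  (TensorProduct.comm k U V).toLinearMap ∘ₗ
    (Module.endTensorEndAlgHom (R := k) (S := k) (A := k)
      (Algebra.TensorProduct.map ρ σ P) : Module.End k (U ⊗[k] V))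

theorem braiding_tmul (a b : A) (ρ : A →ₐ[k] Module.End k U) (σ : A →ₐ[k] Module.End k V)
    (u : U) (v : V) : braiding (a ⊗ₜ b) ρ σ (u ⊗ₜ v) = σ b v ⊗ₜ ρ a u := by
  simp [braiding, Module.endTensorEndAlgHom_apply]

theorem braiding_zero (ρ : A →ₐ[k] Module.End k U) (σ : A →ₐ[k] Module.End k V) :
    braiding 0 ρ σ = 0 := by
  ext; simp [braiding]

theorem braiding_add (P P' : A ⊗[k] A) (ρ : A →ₐ[k] Module.End k U)
    (σ : A →ₐ[k] Module.End k V) :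
    braiding (P + P') ρ σ = braiding P ρ σ + braiding P' ρ σ := by
  ext; simp [braiding]

theorem braiding_natural_left {U' : Type*} [AddCommGroup U'] [Module k U'] (P : A ⊗[k] A)
    (ρ : A →ₐ[k] Module.End k U) (ρ' : A →ₐ[k] Module.End k U') (σ : A →ₐ[k] Module.End k V)
    (f : U →ₗ[k] U') (hf : ∀ a, f ∘ₗ ρ a = ρ' a ∘ₗ f) :
    f.lTensor V ∘ₗ braiding P ρ σ = braiding P ρ' σ ∘ₗ f.rTensor V := by
  induction P with
  | zero => simp [braiding_zero]
  | add x y hx hy =>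
    rw [braiding_add, braiding_add, LinearMap.comp_add, LinearMap.add_comp, hx, hy]
  | tmul a b =>
    ext u v
    have := LinearMap.congr_fun (hf a) u
    simp only [LinearMap.comp_apply] at this
    simp [braiding_tmul, this]

theorem braiding_natural_right {U' : Type*} [AddCommGroup U'] [Module k U'] (P : A ⊗[k] A)
    (ρ : A →ₐ[k] Module.End k U) (ρ' : A →ₐ[k] Module.End k U') (σ : A →ₐ[k] Module.End k V)
    (f : U →ₗ[k] U') (hf : ∀ a, f ∘ₗ ρ a = ρ' a ∘ₗ f) :
    f.rTensor V ∘ₗ braiding P σ ρ = braiding P σ ρ' ∘ₗ f.lTensor V := by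
  induction P with
  | zero => simp [braiding_zero]
  | add x y hx hy =>
    rw [braiding_add, braiding_add, LinearMap.comp_add, LinearMap.add_comp, hx, hy]
  | tmul a b =>
    ext v u
    have := LinearMap.congr_fun (hf b) u
    simp only [LinearMap.comp_apply] at this
    simp [braiding_tmul, this]

/-- The family of morphisms
`(i_U ⊗ id_V) ∘ (id ⊗ c_{V,U}) ∘ (id ⊗ c_{U,V}) : U^∨ ⊗ U ⊗ V → L ⊗ V`. -/
def monodromyFamily (P : A ⊗[k] A) (ρ : A →ₐ[k] Module.End k U) (σ : A →ₐ[k] Module.End k V) :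
    Module.Dual k U ⊗[k] (U ⊗[k] V) →ₗ[k] Module.Dual k A ⊗[k] V :=
  (coendIncl ρ).rTensor V ∘ₗ (TensorProduct.assoc k (Module.Dual k U) U V).symm.toLinearMap ∘ₗ
    (braiding P σ ρ ∘ₗ braiding P ρ σ).lTensor (Module.Dual k U)

/-- The partial monodromy `𝒬_{L,V}`, the endomorphism of `L ⊗ V` induced by the dinatural family
`monodromyFamily`; it is characterized by `partialMonodromy_comp_incl`. -/
def partialMonodromy (P : A ⊗[k] A) (σ : A →ₐ[k] Module.End k V) :
    Module.Dual k A ⊗[k] V →ₗ[k] Module.Dual k A ⊗[k] V :=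
  monodromyFamily P (regRep k A) σ ∘ₗ
    (TensorProduct.mk k A V 1).lTensor (Module.Dual k A)

theorem partialMonodromy_comp_incl (P : A ⊗[k] A) (ρ : A →ₐ[k] Module.End k U)
    (σ : A →ₐ[k] Module.End k V) :
    partialMonodromy P σ ∘ₗ (coendIncl ρ).rTensor V =
      monodromyFamily P ρ σ ∘ₗ
        (TensorProduct.assoc k (Module.Dual k U) U V).toLinearMap := by
  ext φ u v
  let f : A →ₗ[k] U := ρ.toLinearMap.flip u
  have hf : ∀ a, f ∘ₗ regRep k A a = ρ a ∘ₗ f := by intro a; ext b; simp [f]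
  have h1 : u = f 1 := by simp [f]
  have h2 : (braiding P σ ρ ∘ₗ braiding P ρ σ) (u ⊗ₜ v) =
      f.rTensor V ((braiding P σ (regRep k A) ∘ₗ braiding P (regRep k A) σ) (1 ⊗ₜ v)) := by
    have e1 := LinearMap.congr_fun (braiding_natural_left P _ ρ σ f hf) (1 ⊗ₜ v)
    have e2 := LinearMap.congr_fun (braiding_natural_right P _ ρ σ f hf)
      (braiding P (regRep k A) σ (1 ⊗ₜ v))
    simp only [LinearMap.comp_apply, LinearMap.rTensor_tmul] at e1 e2 ⊢
    rw [e2, e1, ← h1]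
  have h3 : ∀ w : A ⊗[k] V,
      (coendIncl (regRep k A)).rTensor V
        ((TensorProduct.assoc k (Module.Dual k A) A V).symm (coendIncl ρ (φ ⊗ₜ u) ⊗ₜ w)) =
      (coendIncl ρ).rTensor V
        ((TensorProduct.assoc k (Module.Dual k U) U V).symm (φ ⊗ₜ f.rTensor V w)) := by
    intro w
    induction w with
    | zero => simp
    | add x y hx hy => simp only [TensorProduct.tmul_add, map_add, hx, hy]
    | tmul b w =>
      simp only [TensorProduct.assoc_symm_tmul, LinearMap.rTensor_tmul]
      congr 1
      exact coendIncl_dinatural _ ρ f hf φ b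
  simp only [partialMonodromy, monodromyFamily, TensorProduct.AlgebraTensorModule.curry_apply,
    TensorProduct.curry_apply, LinearMap.restrictScalars_self, LinearMap.coe_comp,
    LinearEquiv.coe_coe, Function.comp_apply, LinearMap.rTensor_tmul, LinearMap.lTensor_tmul,
    TensorProduct.mk_apply, TensorProduct.assoc_tmul] at h2 h3 ⊢
  rw [h3, h2]

/-- The counit `ε_L`, induced by the family of evaluations `d_U : U^∨ ⊗ U → 𝟙`. -/
def coendCounit (k A : Type*) [Field k] [Ring A] [Algebra k A] : Module.Dual k A →ₗ[k] k :=
  contractLeft k A ∘ₗ (TensorProduct.mk k (Module.Dual k A) A).flip 1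

theorem coendCounit_comp_incl (ρ : A →ₐ[k] Module.End k U) :
    coendCounit k A ∘ₗ coendIncl ρ = contractLeft k U := by
  ext φ u
  simp [coendCounit]

/-- The action `ρ^L_V = (ε_L ⊗ id_V) ∘ 𝒬_{L,V}` of the coend on a module `V`. -/
def coendAction (P : A ⊗[k] A) (σ : A →ₐ[k] Module.End k V) :
    Module.Dual k A ⊗[k] V →ₗ[k] V :=
  (TensorProduct.lid k V).toLinearMap ∘ₗ (coendCounit k A).rTensor V ∘ₗ partialMonodromy P σ

/-- The character of a module `(V, act)` over the coend: the partial trace of the action, formed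
with the sovereign structure `π_V : φ ↦ φ (g · )` given by an element `g ∈ A`. -/
def coendCharacter (g : A) (σ : A →ₐ[k] Module.End k V)
    (act : Module.Dual k A ⊗[k] V →ₗ[k] V) : Module.Dual k A →ₗ[k] k :=
  LinearMap.trace k V ∘ₗ LinearMap.mulLeft k (σ g) ∘ₗ
    (TensorProduct.curry act : Module.Dual k A →ₗ[k] Module.End k V)

end Coend

/-! ## Factorizable ribbon Hopf algebras -/

section Hopf

variable (k H : Type*) [Field k] [Ring H] [HopfAlgebra k H]

/-- `R₁₂`. -/
def leg12 : H ⊗[k] H →ₐ[k] H ⊗[k] (H ⊗[k] H) :=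
  Algebra.TensorProduct.map (AlgHom.id k H) Algebra.TensorProduct.includeLeft

/-- `R₁₃`. -/
def leg13 : H ⊗[k] H →ₐ[k] H ⊗[k] (H ⊗[k] H) :=
  Algebra.TensorProduct.map (AlgHom.id k H) Algebra.TensorProduct.includeRight

/-- `R₂₃`. -/
def leg23 : H ⊗[k] H →ₐ[k] H ⊗[k] (H ⊗[k] H) :=
  Algebra.TensorProduct.includeRight

/-- A quasitriangular structure: an R-matrix. -/
structure Quasitriangular where
  /-- the R-matrix -/
  R : (H ⊗[k] H)ˣ
  intertwine : ∀ h : H, (R : H ⊗[k] H) * Coalgebra.comul (R := k) h =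
    TensorProduct.comm k H H (Coalgebra.comul (R := k) h) * R
  comul_left : TensorProduct.assoc k H H H
      ((Coalgebra.comul (R := k) (A := H)).rTensor H (R : H ⊗[k] H)) =
    leg13 k H R * leg23 k H R
  comul_right : (Coalgebra.comul (R := k) (A := H)).lTensor H (R : H ⊗[k] H) =
    leg13 k H R * leg12 k H R

variable {k H}

/-- `R₂₁`. -/
def Quasitriangular.R21 (D : Quasitriangular k H) : (H ⊗[k] H)ˣ :=
  Units.map (Algebra.TensorProduct.comm k H H : H ⊗[k] H →* H ⊗[k] H) D.R

/-- The monodromy matrix `Q = R₂₁ R`. -/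
def Quasitriangular.Q (D : Quasitriangular k H) : (H ⊗[k] H)ˣ :=
  D.R21 * D.R

/-- The Drinfeld element `u = m ((S ⊗ id) R₂₁)`. -/
def Quasitriangular.u (D : Quasitriangular k H) : H :=
  LinearMap.mul' k H ((HopfAlgebra.antipode k (A := H)).rTensor H (D.R21 : H ⊗[k] H))

variable (k H)

/-- A quasitriangular structure together with a ribbon element. -/
structure Ribbon extends Quasitriangular k H where
  /-- the ribbon element -/
  v : Hˣ
  v_central : ∀ h : H, (v : H) * h = h * v
  antipode_v : HopfAlgebra.antipode k (v : H) = v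
  counit_v : Coalgebra.counit (R := k) (v : H) = 1
  comul_v : Coalgebra.comul (R := k) (v : H) =
    ((v : H) ⊗ₜ[k] (v : H)) * (toQuasitriangular.Q⁻¹ : (H ⊗[k] H)ˣ)

/-- A factorizable ribbon structure: the monodromy matrix is `∑ h_ℓ ⊗ k_ℓ` with `(h_ℓ)` and
`(k_ℓ)` two bases of `H`. -/
structure FactorizableRibbon extends Ribbon k H where
  factorizable : ∃ (n : ℕ) (b c : Module.Basis (Fin n) k H),
    (toQuasitriangular.Q : H ⊗[k] H) = ∑ l, b l ⊗ₜ[k] c l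

variable {k H}

/-- The element `t = u v⁻¹`, which gives the sovereign structure. -/
def Ribbon.t (D : Ribbon k H) : H := D.u * (D.v⁻¹ : Hˣ)

end Hopf

/-! ## The chiral Hopf algebra `L`: the coend in the category of `H`-modules -/

section Chiral

variable {k H : Type*} [Field k] [Ring H] [HopfAlgebra k H]
variable {U V : Type*} [AddCommGroup U] [Module k U] [AddCommGroup V] [Module k V]

/-- The tensor product of `H`-modules. -/
def tensorRep (ρ : H →ₐ[k] Module.End k U) (σ : H →ₐ[k] Module.End k V) :
    H →ₐ[k] Module.End k (U ⊗[k] V) :=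
  (Module.endTensorEndAlgHom (R := k) (S := k) (A := k)).comp
    ((Algebra.TensorProduct.map ρ σ).comp (Bialgebra.comulAlgHom k H))

/-- The dual `U^∨` of an `H`-module: `(h φ) u = φ (S(h) u)`. -/
def dualRep (ρ : H →ₐ[k] Module.End k U) : H →ₐ[k] Module.End k (Module.Dual k U) :=
  AlgHom.ofLinearMap
    (Module.Dual.transpose (R := k) ∘ₗ ρ.toLinearMap ∘ₗ HopfAlgebra.antipode k)
    (by ext; simp [Module.Dual.transpose_apply])
    (by intro a b; ext; simp [Module.Dual.transpose_apply, HopfAlgebra.antipode_mul_antidistrib])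

@[simp]
theorem dualRep_apply (ρ : H →ₐ[k] Module.End k U) (h : H) (φ : Module.Dual k U) (u : U) :
    dualRep ρ h φ u = φ (ρ (HopfAlgebra.antipode k h) u) := rfl

/-- The action of `H` on `H^*` dual to right multiplication: `(h f) x = f (x h)`. -/
def rightTranslate (k H : Type*) [Field k] [Ring H] [HopfAlgebra k H] :
    H →ₐ[k] Module.End k (Module.Dual k H) :=
  AlgHom.ofLinearMap
    (Module.Dual.transpose (R := k) ∘ₗ (LinearMap.mul k H).flip)
    (by ext; simp [Module.Dual.transpose_apply])
    (by intro a b; ext; simp [Module.Dual.transpose_apply, mul_assoc])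

/-- The coadjoint action of `H` on `L = H^*`: `(h f) x = f (S(h₁) x h₂)`. -/
def coadjointRep (k H : Type*) [Field k] [Ring H] [HopfAlgebra k H] :
    H →ₐ[k] Module.End k (Module.Dual k H) :=
  (Algebra.TensorProduct.lift (dualRep (regRep k H)) (rightTranslate k H)
    (by intro a b; ext f x; simp [rightTranslate, Module.Dual.transpose_apply, mul_assoc])).comp
    (Bialgebra.comulAlgHom k H)

theorem coendIncl_equivariant (ρ : H →ₐ[k] Module.End k U) (h : H) :
    coendIncl ρ ∘ₗ tensorRep (dualRep ρ) ρ h = coadjointRep k H h ∘ₗ coendIncl ρ := by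
  simp only [tensorRep, coadjointRep, AlgHom.comp_apply]
  generalize Bialgebra.comulAlgHom k H h = P
  induction P with
  | zero => simp
  | add x y hx hy => simp only [map_add, LinearMap.comp_add, LinearMap.add_comp, hx, hy]
  | tmul a b =>
    ext φ u x
    simp [Module.endTensorEndAlgHom_apply, rightTranslate, Module.Dual.transpose_apply]

/-- The universal property of `L` in the category of `H`-modules: a dinatural family of module
morphisms `U^∨ ⊗ U → B` factors uniquely through the morphisms `i_U`, and the induced map is a
module morphism. -/
theorem coendL_universal {k H : Type u} [Field k] [Ring H] [HopfAlgebra k H]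
    [FiniteDimensional k H] {B : Type u} [AddCommGroup B] [Module k B]
    (τ : H →ₐ[k] Module.End k B)
    (F : ∀ (U : Type u) [AddCommGroup U] [Module k U] [FiniteDimensional k U],
      (H →ₐ[k] Module.End k U) → (Module.Dual k U ⊗[k] U →ₗ[k] B))
    (hτ : ∀ (U : Type u) [AddCommGroup U] [Module k U] [FiniteDimensional k U]
      (ρ : H →ₐ[k] Module.End k U) (h : H),
      F U ρ ∘ₗ tensorRep (dualRep ρ) ρ h = τ h ∘ₗ F U ρ)
    (hF : ∀ (U V : Type u) [AddCommGroup U] [Module k U] [FiniteDimensional k U]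
      [AddCommGroup V] [Module k V] [FiniteDimensional k V]
      (ρ : H →ₐ[k] Module.End k U) (σ : H →ₐ[k] Module.End k V) (f : U →ₗ[k] V),
      (∀ a, f ∘ₗ ρ a = σ a ∘ₗ f) → ∀ (ψ : Module.Dual k V) (u : U),
        F U ρ ((ψ ∘ₗ f) ⊗ₜ u) = F V σ (ψ ⊗ₜ f u)) :
    ∃! κ : Module.Dual k H →ₗ[k] B,
      (∀ h, κ ∘ₗ coadjointRep k H h = τ h ∘ₗ κ) ∧
      ∀ (U : Type u) [AddCommGroup U] [Module k U] [FiniteDimensional k U]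
        (ρ : H →ₐ[k] Module.End k U), κ ∘ₗ coendIncl ρ = F U ρ := by
  obtain ⟨κ, h1, h2⟩ := coendIncl_universal F hF
  refine ⟨κ, ⟨fun h => ?_, h1⟩, fun κ' h' => h2 κ' h'.2⟩
  ext f
  have e : f = coendIncl (regRep k H) (f ⊗ₜ 1) := by ext a; simp
  have e1 := LinearMap.congr_fun (coendIncl_equivariant (regRep k H) h) (f ⊗ₜ 1)
  have e2 := LinearMap.congr_fun (hτ H (regRep k H) h) (f ⊗ₜ 1)
  rw [← h1 H (regRep k H)] at e2
  simp only [LinearMap.comp_apply] at e1 e2 ⊢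
  rw [e1, ← e] at e2
  exact e2

/-- The family
`(d_U ⊗ i_{U^∨}) ∘ (id ⊗ c_{U^∨∨,U} ⊗ id) ∘ (b_{U^∨} ⊗ c_{U^∨,U}) : U^∨ ⊗ U → L`, where the
first braiding `c_{U^∨∨,U}` is determined by `P` and the second one by `P'`; for the antipode both
are the R-matrix. -/
def antipodeFamily [FiniteDimensional k U] (P P' : H ⊗[k] H)
    (ρ : H →ₐ[k] Module.End k U) : Module.Dual k U ⊗[k] U →ₗ[k] Module.Dual k H :=
  (TensorProduct.lid k (Module.Dual k H)).toLinearMap ∘ₗ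
    TensorProduct.map (contractLeft k U) (coendIncl (dualRep ρ)) ∘ₗ
    (TensorProduct.tensorTensorTensorAssoc k (Module.Dual k U) U
      (Module.Dual k (Module.Dual k U)) (Module.Dual k U)).symm.toLinearMap ∘ₗ
    ((braiding P (dualRep (dualRep ρ)) ρ).lTensor
      (Module.Dual k U)).rTensor (Module.Dual k U) ∘ₗ
    (TensorProduct.tensorTensorTensorAssoc k (Module.Dual k U)
      (Module.Dual k (Module.Dual k U)) U (Module.Dual k U)).toLinearMap ∘ₗ
    TensorProduct.map (coevaluation k (Module.Dual k U)) (braiding P' (dualRep ρ) ρ) ∘ₗ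
    (TensorProduct.lid k (Module.Dual k U ⊗[k] U)).symm.toLinearMap

theorem antipodeFamily_tmul [FiniteDimensional k U] (a b a' b' : H)
    (ρ : H →ₐ[k] Module.End k U) (φ : Module.Dual k U) (u : U) (h : H) :
    antipodeFamily (a ⊗ₜ b) (a' ⊗ₜ b') ρ (φ ⊗ₜ u) h =
      φ (ρ (HopfAlgebra.antipode k a' * HopfAlgebra.antipode k h *
        HopfAlgebra.antipode k (HopfAlgebra.antipode k a) * b * b') u) := by
  simp only [antipodeFamily, LinearMap.comp_apply, LinearEquiv.coe_coe,
    TensorProduct.lid_symm_apply, TensorProduct.map_tmul, coevaluation_apply_one, braiding_tmul,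
    TensorProduct.sum_tmul, map_sum, TensorProduct.tensorTensorTensorAssoc_tmul,
    LinearMap.rTensor_tmul, LinearMap.lTensor_tmul,
    TensorProduct.tensorTensorTensorAssoc_symm_tmul, TensorProduct.lid_tmul,
    contractLeft_apply, LinearMap.sum_apply, LinearMap.smul_apply, coendIncl_tmul,
    dualRep_apply, Module.Basis.coord_apply, smul_eq_mul]
  set y : U := ρ b (ρ b' u)
  set χ : Module.Dual k U := dualRep ρ (HopfAlgebra.antipode k a) (dualRep ρ h
    (dualRep ρ a' φ)) with hχ
  have h1 := congrArg (fun ψ : Module.Dual k U => ψ y)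
    ((Module.Basis.ofVectorSpace k (Module.Dual k U)).sum_repr χ)
  simp only [LinearMap.sum_apply, LinearMap.smul_apply, smul_eq_mul] at h1
  rw [Finset.sum_congr rfl fun i _ => mul_comm _ _]
  refine h1.trans ?_
  simp [hχ, y, mul_assoc]

theorem antipodeFamily_add_left [FiniteDimensional k U] (P₁ P₂ P' : H ⊗[k] H)
    (ρ : H →ₐ[k] Module.End k U) :
    antipodeFamily (P₁ + P₂) P' ρ = antipodeFamily P₁ P' ρ + antipodeFamily P₂ P' ρ := by
  simp only [antipodeFamily, braiding_add, LinearMap.lTensor_add, LinearMap.rTensor_add,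
    LinearMap.comp_add, LinearMap.add_comp]

theorem antipodeFamily_add_right [FiniteDimensional k U] (P P₁ P₂ : H ⊗[k] H)
    (ρ : H →ₐ[k] Module.End k U) :
    antipodeFamily P (P₁ + P₂) ρ = antipodeFamily P P₁ ρ + antipodeFamily P P₂ ρ := by
  simp only [antipodeFamily, braiding_add, TensorProduct.map_add_right,
    LinearMap.comp_add, LinearMap.add_comp]

/-- The antipode of `L`, induced by the dinatural family `antipodeFamily`; it is characterized by
`antipodeL_comp_incl`. -/
def antipodeL [FiniteDimensional k H] (D : Quasitriangular k H) :
    Module.Dual k H →ₗ[k] Module.Dual k H :=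
  antipodeFamily D.R D.R (regRep k H) ∘ₗ (TensorProduct.mk k (Module.Dual k H) H).flip 1

theorem antipodeL_comp_incl [FiniteDimensional k H] [FiniteDimensional k U]
    (D : Quasitriangular k H) (ρ : H →ₐ[k] Module.End k U) :
    antipodeL D ∘ₗ coendIncl ρ = antipodeFamily D.R D.R ρ := by
  have key : ∀ (P P' : H ⊗[k] H) (φ : Module.Dual k U) (u : U),
      antipodeFamily P P' (regRep k H) (coendIncl ρ (φ ⊗ₜ u) ⊗ₜ 1) =
        antipodeFamily P P' ρ (φ ⊗ₜ u) := by
    intro P P' φ u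
    induction P with
    | zero => simp [antipodeFamily, braiding_zero]
    | add x y hx hy =>
      rw [antipodeFamily_add_left, antipodeFamily_add_left, LinearMap.add_apply,
        LinearMap.add_apply, hx, hy]
    | tmul a b =>
      induction P' with
      | zero => simp [antipodeFamily, braiding_zero]
      | add x y hx hy =>
        rw [antipodeFamily_add_right, antipodeFamily_add_right, LinearMap.add_apply,
          LinearMap.add_apply, hx, hy]
      | tmul a' b' =>
        ext h
        simp [antipodeFamily_tmul]
  ext φ u : 3
  exact key _ _ φ u

/-- The `L`-module dual to `(M, act)`: the action on `M^∨` is the transpose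
`φ ⊗ f ↦ φ (act (f ⊗ · ))` precomposed with `c_{L, M^∨} ∘ (S_L ⊗ id)`. -/
def dualActionL [FiniteDimensional k H] (D : Quasitriangular k H)
    (σ : H →ₐ[k] Module.End k V) (act : Module.Dual k H ⊗[k] V →ₗ[k] V) :
    Module.Dual k H ⊗[k] Module.Dual k V →ₗ[k] Module.Dual k V :=
  TensorProduct.lift (Module.Dual.transpose (R := k) ∘ₗ TensorProduct.curry act).flip ∘ₗ
    braiding (D.R : H ⊗[k] H) (coadjointRep k H) (dualRep σ) ∘ₗ
    (antipodeL D).rTensor (Module.Dual k V)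

variable (M : Type*) [AddCommGroup M] [Module k M] [Module H M] [IsScalarTower k H M]

/-- The character `χ^L_M` of the `L`-module `(M, ρ^L_M)`. -/
def chiralCharacter (D : Ribbon k H) : Module.Dual k H →ₗ[k] k :=
  coendCharacter D.t (Algebra.lsmul k k M) (coendAction (D.R : H ⊗[k] H) (Algebra.lsmul k k M))

/-- The character of the `L`-module dual to `(M, ρ^L_M)`. -/
def chiralDualCharacter [FiniteDimensional k H] (D : Ribbon k H) : Module.Dual k H →ₗ[k] k :=
  coendCharacter D.t (dualRep (Algebra.lsmul k k M))
    (dualActionL D.toQuasitriangular (Algebra.lsmul k k M)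
      (coendAction (D.R : H ⊗[k] H) (Algebra.lsmul k k M)))

end Chiral

/-! ## The bulk Hopf algebra `K`: the coend in the category of `H`-bimodules

An `H`-bimodule is a left module over `H ⊗ H^op`. -/

section Bulk

variable {k H : Type*} [Field k] [Ring H] [HopfAlgebra k H]

/-- The element of `(H ⊗ H^op) ⊗ (H ⊗ H^op)` describing the braiding
`x ⊗ y ↦ τ (R₂₁⁻¹ · (x ⊗ y) · R₂₁)` of `H`-bimodules: the opposite of the braiding of `H`-modules
for the left actions, and the braiding for the right actions. -/
def bulkBraidingElement (D : Quasitriangular k H) :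
    (H ⊗[k] Hᵐᵒᵖ) ⊗[k] (H ⊗[k] Hᵐᵒᵖ) :=
  TensorProduct.tensorTensorTensorComm k H H Hᵐᵒᵖ Hᵐᵒᵖ
    (((D.R21⁻¹ : (H ⊗[k] H)ˣ) : H ⊗[k] H) ⊗ₜ[k]
      TensorProduct.map (MulOpposite.opLinearEquiv k).toLinearMap
        (MulOpposite.opLinearEquiv k).toLinearMap (D.R21 : H ⊗[k] H))

/-- The vector space `H^* ⊗ H^*` underlying `K` (and `L ⊗ L`), as the coend `(H ⊗ H^op)^*`:
`f ⊗ g` is the functional `h ⊗ h' ↦ f(h) g(h')`. -/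
def bulkIdent (k H : Type*) [Field k] [Ring H] [HopfAlgebra k H] [FiniteDimensional k H] :
    Module.Dual k H ⊗[k] Module.Dual k H ≃ₗ[k] Module.Dual k (H ⊗[k] Hᵐᵒᵖ) :=
  TensorProduct.congr (LinearEquiv.refl k _) (MulOpposite.opLinearEquiv k).symm.dualMap ≪≫ₗ
    TensorProduct.dualDistribEquiv k H Hᵐᵒᵖ

theorem bulkIdent_apply [FiniteDimensional k H] (f g : Module.Dual k H) (h h' : H) :
    bulkIdent k H (f ⊗ₜ g) (h ⊗ₜ MulOpposite.op h') = f h * g h' := by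
  simp [bulkIdent]

/-- The character `χ^K_X` of the `K`-module `(X, ρ^K_X)`, as a linear form on `K = H^* ⊗ H^*`. The
sovereign structure of the category of bimodules is given by the left and right action of `t`. -/
def bulkCharacter [FiniteDimensional k H] (D : Ribbon k H) (X : Type*) [AddCommGroup X]
    [Module k X] [Module (H ⊗[k] Hᵐᵒᵖ) X] [IsScalarTower k (H ⊗[k] Hᵐᵒᵖ) X] :
    Module.Dual k H ⊗[k] Module.Dual k H →ₗ[k] k :=
  coendCharacter (D.t ⊗ₜ[k] MulOpposite.op D.t) (Algebra.lsmul k k X)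
    (coendAction (bulkBraidingElement D.toQuasitriangular) (Algebra.lsmul k k X)) ∘ₗ
    (bulkIdent k H).toLinearMap

variable (k H)
variable (S T : Type*) [AddCommGroup S] [Module k S] [Module H S] [IsScalarTower k H S]
  [AddCommGroup T] [Module k T] [Module H T] [IsScalarTower k H T]

/-- The right `H`-module `T^*`, i.e. `(φ h) x = φ (h x)`, as a left `H^op`-module. -/
def opDualRep : Hᵐᵒᵖ →ₐ[k] Module.End k (Module.Dual k T) :=
  AlgHom.ofLinearMap
    (Module.Dual.transpose (R := k) ∘ₗ (Algebra.lsmul k k T : H →ₐ[k] Module.End k T).toLinearMap ∘ₗ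
      (MulOpposite.opLinearEquiv k).symm.toLinearMap)
    (by ext; simp [Module.Dual.transpose_apply])
    (by intro a b; ext; simp [Module.Dual.transpose_apply])

variable {H}

/-- The vector space `S ⊗ T^*`. -/
def OuterBimodule (S T : Type*) [AddCommGroup S] [Module k S] [AddCommGroup T] [Module k T] :
    Type _ :=
  S ⊗[k] Module.Dual k T

instance : AddCommGroup (OuterBimodule k S T) :=
  inferInstanceAs (AddCommGroup (S ⊗[k] Module.Dual k T))

/-- The `H ⊗ H^op`-module `S ⊗ T^*`, with `(h ⊗ h') (s ⊗ φ) = h s ⊗ φ (h' · )`. -/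
instance : Module (H ⊗[k] Hᵐᵒᵖ) (OuterBimodule k S T) :=
  Module.compHom (S ⊗[k] Module.Dual k T)
    ((Module.endTensorEndAlgHom (R := k) (S := k) (A := k)).comp
      (Algebra.TensorProduct.map (Algebra.lsmul k k S : H →ₐ[k] Module.End k S)
        (opDualRep k H T))).toRingHom

theorem outerBimodule_smul (h h' : H) (s : S) (φ : Module.Dual k T) :
    (h ⊗ₜ[k] MulOpposite.op h') • (show OuterBimodule k S T from s ⊗ₜ[k] φ) =
      ((h • s) ⊗ₜ[k] (φ ∘ₗ Algebra.lsmul k k T h') : S ⊗[k] Module.Dual k T) := rfl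

end Bulk

end

end BulkCharacter

/-! A coend built from a braiding element `P` acts on a module through `P₂₁ P`, sliced by the
functional (`coendAction_tmul`). For `L` this element is the monodromy `Q`. For `K` it is `Q⁻¹` on
the left tensor factors and `Q` on the right ones (`comm_bulkBraidingElement_mul`). Hence the bulk
character at `f ⊗ g` is the trace over `X` of an explicit element of `H ⊗ H^op`
(`bulkCharacter_tmul`).

Traces are additive on short exact sequences, so the trace over `X` is the sum over the composition
factors (`moduleTrace_eq_sum_jhMultiplicity`). Over an algebraically closed field the simple
bimodules are the `S_i ⊗ S_j^*`, pairwise non-isomorphic for different pairs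
(`exists_nonempty_equiv_outerBimodule`, `nonempty_equiv_of_outerBimodule_equiv`), and the trace over
`S_i ⊗ S_j^*` is a product. The `S_j` factor is the chiral character by cyclicity of the trace.

What remains is to recognise the `S_i` factor, in which `Q⁻¹` replaces `Q`, as the character of the
dual `L`-module (`chiralDualCharacter_apply`). Let `T` be the trace over `S_i` and `c = T(t Q'')
Q'`. Since `Q` commutes with coproducts and `S(h₂) t h₁ = ε(h) t`, the element `c` is central. The
braiding and the sovereign structure of the dual module combine into a single `t`
(`Ribbon.sum_antipode_mul_antipode_t`), so the dual character is `(S_L f)(c)`. On central elements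
`S_L` is the transpose of `S`, and applying `S` to `c` turns `Q` into `Q⁻¹`
(`Ribbon.antipode_traceSlice_t`). -/

namespace BulkCharacter

noncomputable section

open HopfAlgebra Coalgebra

/-! ### Sweedler identities for the antipode -/

section HopfIdentities

variable {k H : Type*} [Field k] [Ring H] [HopfAlgebra k H]

/-- The linear map `x ⊗ y ↦ S(x) y`. -/
def antipodeMul (k H : Type*) [Field k] [Ring H] [HopfAlgebra k H] : H ⊗[k] H →ₗ[k] H :=
  LinearMap.mul' k H ∘ₗ (antipode k).rTensor H

/-- The linear map `x ⊗ y ↦ x S(y)`. -/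
def mulAntipode (k H : Type*) [Field k] [Ring H] [HopfAlgebra k H] : H ⊗[k] H →ₗ[k] H :=
  LinearMap.mul' k H ∘ₗ (antipode k).lTensor H

@[simp]
theorem antipodeMul_tmul (x y : H) : antipodeMul k H (x ⊗ₜ y) = antipode k x * y := by
  simp [antipodeMul]

@[simp]
theorem mulAntipode_tmul (x y : H) : mulAntipode k H (x ⊗ₜ y) = x * antipode k y := by
  simp [mulAntipode]

theorem antipodeMul_comp_comul :
    antipodeMul k H ∘ₗ comul = Algebra.linearMap k H ∘ₗ counit := by
  rw [antipodeMul, LinearMap.comp_assoc, mul_antipode_rTensor_comul]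

theorem mulAntipode_comp_comul :
    mulAntipode k H ∘ₗ comul = Algebra.linearMap k H ∘ₗ counit := by
  rw [mulAntipode, LinearMap.comp_assoc, mul_antipode_lTensor_comul]

/-- `S(h₁) h₂ ⊗ h₃ = 1 ⊗ h`. -/
theorem antipodeMul_rTensor_coassoc (h : H) :
    (antipodeMul k H).rTensor H ((TensorProduct.assoc k H H H).symm
      ((comul (R := k)).lTensor H (comul (R := k) h))) = 1 ⊗ₜ h := by
  rw [coassoc_symm_apply, ← LinearMap.comp_apply, ← LinearMap.rTensor_comp,
    antipodeMul_comp_comul, LinearMap.rTensor_comp, LinearMap.comp_apply,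
    rTensor_counit_comul]
  simp

/-- `h₁ ⊗ h₂ S(h₃) = h ⊗ 1`. -/
theorem mulAntipode_lTensor_coassoc (h : H) :
    (mulAntipode k H).lTensor H (TensorProduct.assoc k H H H
      ((comul (R := k)).rTensor H (comul (R := k) h))) = h ⊗ₜ 1 := by
  rw [coassoc_apply, ← LinearMap.comp_apply, ← LinearMap.lTensor_comp,
    mulAntipode_comp_comul, LinearMap.lTensor_comp, LinearMap.comp_apply,
    lTensor_counit_comul]
  simp

/-- `Δ(h₁) (1 ⊗ S(h₂)) = h ⊗ 1`. -/
theorem sum_comul_mul_antipode_eq (h : H) {ι : Type*} (𝓡 : Repr k h ι) :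
    ∑ i ∈ 𝓡.index, comul (R := k) (𝓡.left i) * (1 ⊗ₜ[k] antipode k (𝓡.right i)) =
      h ⊗ₜ[k] (1 : H) := by
  have key : ∀ z : H ⊗[k] H, ∀ y : H, z * (1 ⊗ₜ[k] antipode k y) =
      (mulAntipode k H).lTensor H (TensorProduct.assoc k H H H (z ⊗ₜ y)) := by
    intro z y
    induction z with
    | zero => simp
    | add a b ha hb => rw [add_mul, ha, hb, TensorProduct.add_tmul, map_add, map_add]
    | tmul a b => simp
  rw [← mulAntipode_lTensor_coassoc (k := k) h, ← 𝓡.eq]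
  simp only [map_sum, LinearMap.rTensor_tmul, key]

/-- `(S(h₁) ⊗ 1) Δ(h₂) = 1 ⊗ h`. -/
theorem sum_antipode_mul_comul_eq (h : H) {ι : Type*} (𝓡 : Repr k h ι) :
    ∑ i ∈ 𝓡.index, (antipode k (𝓡.left i) ⊗ₜ[k] 1) * comul (R := k) (𝓡.right i) =
      (1 : H) ⊗ₜ[k] h := by
  have key : ∀ z : H ⊗[k] H, ∀ x : H, (antipode k x ⊗ₜ[k] 1) * z =
      (antipodeMul k H).rTensor H ((TensorProduct.assoc k H H H).symm (x ⊗ₜ z)) := by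
    intro z x
    induction z with
    | zero => simp
    | add a b ha hb => rw [mul_add, ha, hb, TensorProduct.tmul_add, map_add, map_add]
    | tmul a b => simp
  rw [← antipodeMul_rTensor_coassoc (k := k) h, ← 𝓡.eq]
  simp only [map_sum, LinearMap.lTensor_tmul, key]

/-- If `X` commutes with all coproducts, then `S(h₁) X' h₂ ⊗ X'' = X' ⊗ h₁ X'' S(h₂)`. -/
theorem sum_antipode_mul_mul_eq (X : H ⊗[k] H)
    (hX : ∀ h : H, X * comul (R := k) h = comul (R := k) h * X)
    (h : H) {ι : Type*} (𝓡 : Repr k h ι) :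
    ∑ i ∈ 𝓡.index, (antipode k (𝓡.left i) ⊗ₜ[k] 1) * X * (𝓡.right i ⊗ₜ[k] 1) =
      ∑ i ∈ 𝓡.index, ((1 : H) ⊗ₜ[k] 𝓡.left i) * X * (1 ⊗ₜ[k] antipode k (𝓡.right i)) := by
  -- The map `a ⊗ b ⊗ c ↦ (S(a) ⊗ 1) X Δ(b) (1 ⊗ S(c))` is applied to both sides of coassociativity.
  -- In one bracketing `Δ(b) (1 ⊗ S(c))` collapses; in the other, after `X` is moved past `Δ(b)`,
  -- `(S(a) ⊗ 1) Δ(b)` collapses.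
  let f : H ⊗[k] (H ⊗[k] H) →ₗ[k] H ⊗[k] H := LinearMap.mul' k (H ⊗[k] H) ∘ₗ
    TensorProduct.map ((TensorProduct.mk k H H).flip 1 ∘ₗ antipode k)
      (LinearMap.mul' k (H ⊗[k] H) ∘ₗ TensorProduct.map
        (LinearMap.mulLeft k X ∘ₗ comul) (TensorProduct.mk k H H 1 ∘ₗ antipode k))
  have hf : ∀ a b c : H, f (a ⊗ₜ (b ⊗ₜ c)) =
      (antipode k a ⊗ₜ[k] 1) * (X * comul (R := k) b * (1 ⊗ₜ antipode k c)) := by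
    intro a b c; simp [f]
  have := congrArg f (sum_tmul_tmul_eq (R := k) 𝓡 (fun i => Repr.arbitrary k _)
    (fun i => Repr.arbitrary k _)).symm
  simp only [map_sum, hf] at this
  trans
  · trans
    swap
    · exact this
    refine Finset.sum_congr rfl fun i _ => ?_
    rw [← Finset.mul_sum]
    simp only [mul_assoc]
    rw [← Finset.mul_sum, sum_comul_mul_antipode_eq]
  · refine Finset.sum_congr rfl fun i _ => ?_
    simp only [hX, ← mul_assoc]
    rw [← Finset.sum_mul, ← Finset.sum_mul, sum_antipode_mul_comul_eq]

end HopfIdentities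

/-! ### Counit and antipode on the R-matrix -/

section Quasitriangular

variable {k H : Type*} [Field k] [Ring H] [HopfAlgebra k H] (D : Quasitriangular k H)

open Quasitriangular

/-- Applying `ε` to the first leg of `(Δ ⊗ id)(R) = R₁₃ R₂₃` gives `R = (1 ⊗ (ε ⊗ id)(R)) R`, and
`R` is invertible. -/
theorem Quasitriangular.counit_rTensor_R :
    TensorProduct.lid k H ((counit (R := k) (A := H)).rTensor H (D.R : H ⊗[k] H)) = 1 := by
  let p : H ⊗[k] (H ⊗[k] H) →ₐ[k] H ⊗[k] H := (Algebra.TensorProduct.lid k (H ⊗[k] H)).toAlgHom.comp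
    (Algebra.TensorProduct.map (Bialgebra.counitAlgHom k H) (AlgHom.id k _))
  have h0 : ∀ x : H ⊗[k] H, p (TensorProduct.assoc k H H H ((comul (R := k)).rTensor H x)) = x := by
    intro x
    induction x with
    | zero => simp
    | add x y hx hy => simp only [map_add, hx, hy]
    | tmul a b =>
      have : ∀ z : H ⊗[k] H, p (TensorProduct.assoc k H H H (z ⊗ₜ b)) =
          TensorProduct.lid k H ((counit (R := k)).rTensor H z) ⊗ₜ b := by
        intro z
        induction z with
        | zero => simp
        | add x y hx hy => simp only [map_add, TensorProduct.add_tmul, hx, hy]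
        | tmul c d => simp [p, TensorProduct.smul_tmul']
      rw [LinearMap.rTensor_tmul, this, rTensor_counit_comul]
      simp
  have h := congrArg p D.comul_left
  rw [h0, map_mul] at h
  have h2 : p (leg23 k H D.R) = D.R := by simp [p, leg23]
  rw [h2] at h
  have h3 : p (leg13 k H D.R) = 1 := by
    have := congrArg (· * ((D.R⁻¹ : (H ⊗[k] H)ˣ) : H ⊗[k] H)) h
    simpa [mul_assoc] using this.symm
  have h4 : ∀ x : H ⊗[k] H, TensorProduct.lid k H ((counit (R := k)).rTensor H (p (leg13 k H x))) =
      TensorProduct.lid k H ((counit (R := k)).rTensor H x) := by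
    intro x
    induction x with
    | zero => simp
    | add x y hx hy => simp only [map_add, hx, hy]
    | tmul a b => simp [p, leg13]
  rw [← h4, h3, Algebra.TensorProduct.one_def]
  simp

/-- The same cancellation, with `ε` applied to the last leg of `(id ⊗ Δ)(R) = R₁₃ R₁₂`. -/
theorem Quasitriangular.counit_lTensor_R :
    TensorProduct.rid k H ((counit (R := k) (A := H)).lTensor H (D.R : H ⊗[k] H)) = 1 := by
  let p : H ⊗[k] (H ⊗[k] H) →ₐ[k] H ⊗[k] H := Algebra.TensorProduct.map (AlgHom.id k H)
    ((Algebra.TensorProduct.rid k k H).toAlgHom.comp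
      (Algebra.TensorProduct.map (AlgHom.id k H) (Bialgebra.counitAlgHom k H)))
  have h0 : ∀ x : H ⊗[k] H, p ((comul (R := k)).lTensor H x) = x := by
    intro x
    induction x with
    | zero => simp
    | add x y hx hy => simp only [map_add, hx, hy]
    | tmul a b =>
      have : ∀ z : H ⊗[k] H, p (a ⊗ₜ z) =
          a ⊗ₜ TensorProduct.rid k H ((counit (R := k)).lTensor H z) := by
        intro z
        induction z with
        | zero => simp
        | add x y hx hy => simp only [map_add, TensorProduct.tmul_add, hx, hy]
        | tmul c d => simp [p]
      rw [LinearMap.lTensor_tmul, this, lTensor_counit_comul]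
      simp
  have h := congrArg p D.comul_right
  rw [h0, map_mul] at h
  have h2 : ∀ x : H ⊗[k] H, p (leg12 k H x) = x := by
    intro x
    induction x with
    | zero => simp
    | add x y hx hy => simp only [map_add, hx, hy]
    | tmul a b => simp [p, leg12]
  rw [h2] at h
  have h3 : p (leg13 k H D.R) = 1 := by
    have := congrArg (· * ((D.R⁻¹ : (H ⊗[k] H)ˣ) : H ⊗[k] H)) h
    simpa [mul_assoc] using this.symm
  have h4 : ∀ x : H ⊗[k] H, TensorProduct.rid k H ((counit (R := k)).lTensor H (p (leg13 k H x))) =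
      TensorProduct.rid k H ((counit (R := k)).lTensor H x) := by
    intro x
    induction x with
    | zero => simp
    | add x y hx hy => simp only [map_add, hx, hy]
    | tmul a b => simp [p, leg13]
  rw [← h4, h3, Algebra.TensorProduct.one_def]
  simp

/-- `(S ⊗ id)(R) R = 1`. -/
theorem Quasitriangular.antipode_rTensor_R_mul :
    (antipode k (A := H)).rTensor H (D.R : H ⊗[k] H) * D.R = 1 := by
  have h := congrArg (fun x => (antipodeMul k H).rTensor H ((TensorProduct.assoc k H H H).symm x))
    D.comul_left
  have key : ∀ x y : H ⊗[k] H, (antipodeMul k H).rTensor H ((TensorProduct.assoc k H H H).symm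
      (leg13 k H x * leg23 k H y)) = (antipode k (A := H)).rTensor H x * y := by
    intro x y
    induction x with
    | zero => simp
    | add x x' hx hx' => simp only [map_add, add_mul, hx, hx']
    | tmul a b =>
      induction y with
      | zero => simp
      | add x x' hx hx' => simp only [map_add, mul_add, hx, hx']
      | tmul c d => simp [leg13, leg23]
  simp only [LinearEquiv.symm_apply_apply] at h
  rw [key, ← LinearMap.comp_apply, ← LinearMap.rTensor_comp, antipodeMul_comp_comul,
    LinearMap.rTensor_comp, LinearMap.comp_apply] at h
  have e : (counit (R := k) (A := H)).rTensor H (D.R : H ⊗[k] H) = 1 ⊗ₜ 1 := by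
    apply (TensorProduct.lid k H).injective
    rw [D.counit_rTensor_R]; simp
  rw [← h, e]
  simp [Algebra.TensorProduct.one_def]

theorem Quasitriangular.antipode_rTensor_R :
    (antipode k (A := H)).rTensor H (D.R : H ⊗[k] H) = (D.R⁻¹ : (H ⊗[k] H)ˣ) :=
  (Units.inv_eq_of_mul_eq_one_left D.antipode_rTensor_R_mul).symm

/-- Replacing `Δ` by `x ↦ x₁ S(x₂) = ε(x)` in `(id ⊗ Δ)(R)`. This says that `(id ⊗ S)(R)` is a left
inverse of `R` in `H ⊗ H^op`, the counterpart of `antipode_rTensor_R_mul`. -/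
theorem Quasitriangular.mulAntipode_leg :
    (mulAntipode k H).lTensor H (leg13 k H D.R * leg12 k H D.R) = 1 ⊗ₜ 1 := by
  rw [← D.comul_right, ← LinearMap.comp_apply, ← LinearMap.lTensor_comp, mulAntipode_comp_comul,
    LinearMap.lTensor_comp, LinearMap.comp_apply]
  have e : (counit (R := k) (A := H)).lTensor H (D.R : H ⊗[k] H) = 1 ⊗ₜ 1 := by
    apply (TensorProduct.rid k H).injective
    rw [D.counit_lTensor_R]; simp
  rw [e]
  simp

end Quasitriangular

/-! ### Formulas for `R⁻¹`, `u`, `Q`, `Q⁻¹` in terms of `R = ∑ a_i ⊗ b_i` -/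

section Expansion

variable {k H : Type*} [Field k] [Ring H] [HopfAlgebra k H] (D : Quasitriangular k H)
variable {ι : Type*} {s : Finset ι} {a b : ι → H}

theorem sum_antipode_mul_tmul_mul (hR : (D.R : H ⊗[k] H) = ∑ i ∈ s, a i ⊗ₜ b i) :
    ∑ i ∈ s, ∑ j ∈ s, (antipode k (a i) * a j) ⊗ₜ[k] (b i * b j) = 1 := by
  rw [← D.antipode_rTensor_R_mul, hR]
  simp [Finset.sum_mul_sum]

theorem sum_mul_tmul_mul_antipode (hR : (D.R : H ⊗[k] H) = ∑ i ∈ s, a i ⊗ₜ b i) :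
    ∑ i ∈ s, ∑ j ∈ s, (a i * a j) ⊗ₜ[k] (b j * antipode k (b i)) = 1 := by
  have := D.mulAntipode_leg
  rw [hR] at this
  simpa [Finset.sum_mul_sum, leg13, leg12, Algebra.TensorProduct.one_def] using this

/-- Applying `S ⊗ id` to `∑ a_i a_j ⊗ b_j S(b_i) = 1` yields `(S ⊗ id)(R) (S ⊗ S)(R) = 1`, whose
first factor is `R⁻¹`. -/
theorem antipode_map_R :
    TensorProduct.map (antipode k) (antipode k) (D.R : H ⊗[k] H) = D.R := by
  obtain ⟨s, hR⟩ := TensorProduct.exists_finset (D.R : H ⊗[k] H)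
  have h := congrArg ((antipode k (A := H)).rTensor H) (sum_mul_tmul_mul_antipode D hR)
  have h2 : ((D.R⁻¹ : (H ⊗[k] H)ˣ) : H ⊗[k] H) *
      TensorProduct.map (antipode k) (antipode k) (D.R : H ⊗[k] H) = 1 := by
    rw [← D.antipode_rTensor_R, hR]
    simp only [map_sum, LinearMap.rTensor_tmul, antipode_mul_antidistrib,
      Algebra.TensorProduct.one_def, antipode_one] at h
    rw [Algebra.TensorProduct.one_def, ← h, Finset.sum_comm]
    simp [Finset.sum_mul_sum]
  have := congrArg (fun x => (D.R : H ⊗[k] H) * x) h2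
  simpa [← mul_assoc] using this

theorem inv_R_eq_sum (hR : (D.R : H ⊗[k] H) = ∑ i ∈ s, a i ⊗ₜ b i) :
    ((D.R⁻¹ : (H ⊗[k] H)ˣ) : H ⊗[k] H) = ∑ i ∈ s, antipode k (a i) ⊗ₜ b i := by
  rw [← D.antipode_rTensor_R, hR]
  simp

theorem inv_R_eq_sum' (hR : (D.R : H ⊗[k] H) = ∑ i ∈ s, a i ⊗ₜ b i) :
    ((D.R⁻¹ : (H ⊗[k] H)ˣ) : H ⊗[k] H) =
      ∑ i ∈ s, antipode k (antipode k (a i)) ⊗ₜ antipode k (b i) := by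
  rw [← D.antipode_rTensor_R, ← antipode_map_R, hR]
  simp

theorem R21_eq_sum (hR : (D.R : H ⊗[k] H) = ∑ i ∈ s, a i ⊗ₜ b i) :
    (D.R21 : H ⊗[k] H) = ∑ i ∈ s, b i ⊗ₜ a i := by
  simp [Quasitriangular.R21, hR]

theorem u_eq_sum (hR : (D.R : H ⊗[k] H) = ∑ i ∈ s, a i ⊗ₜ b i) :
    D.u = ∑ i ∈ s, antipode k (b i) * a i := by
  simp [Quasitriangular.u, R21_eq_sum D hR]

theorem Q_eq_sum (hR : (D.R : H ⊗[k] H) = ∑ i ∈ s, a i ⊗ₜ b i) :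
    (D.Q : H ⊗[k] H) = ∑ i ∈ s, ∑ j ∈ s, (b i * a j) ⊗ₜ (a i * b j) := by
  simp [Quasitriangular.Q, R21_eq_sum D hR, hR, Finset.sum_mul_sum]

/-- `R⁻¹` is expanded as `S(a) ⊗ b`, but `R₂₁⁻¹` as `S(b) ⊗ S²(a)`. This mixed choice makes the
first leg `S(b_i a_j)`, so that `Ribbon.antipode_traceSlice_t` can compare with `Q` term by term. -/
theorem inv_Q_eq_sum (hR : (D.R : H ⊗[k] H) = ∑ i ∈ s, a i ⊗ₜ b i) :
    ((D.Q⁻¹ : (H ⊗[k] H)ˣ) : H ⊗[k] H) =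
      ∑ i ∈ s, ∑ j ∈ s, (antipode k (a j) * antipode k (b i)) ⊗ₜ
        (b j * antipode k (antipode k (a i))) := by
  have h21 : ((D.R21⁻¹ : (H ⊗[k] H)ˣ) : H ⊗[k] H) =
      ∑ i ∈ s, antipode k (b i) ⊗ₜ antipode k (antipode k (a i)) := by
    rw [Quasitriangular.R21, ← map_inv, Units.coe_map, inv_R_eq_sum' D hR]
    simp
  rw [Quasitriangular.Q, mul_inv_rev, Units.val_mul, h21, inv_R_eq_sum D hR, Finset.sum_mul_sum,
    Finset.sum_comm]
  simp

/-- `R` carries `Δ` to the opposite coproduct and `R₂₁` carries it back. -/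
theorem Quasitriangular.Q_mul_comul (h : H) :
    (D.Q : H ⊗[k] H) * comul (R := k) h = comul (R := k) h * D.Q := by
  have h1 := congrArg (Algebra.TensorProduct.comm k H H) (D.intertwine h)
  simp only [map_mul] at h1
  have h2 : (Algebra.TensorProduct.comm k H H)
    ((TensorProduct.comm k H H) (comul (R := k) h)) = comul (R := k) h :=
    (TensorProduct.comm k H H).symm_apply_apply _
  rw [h2] at h1
  rw [Quasitriangular.Q, Units.val_mul, mul_assoc, D.intertwine, ← mul_assoc]
  refine (congrArg (· * (D.R : H ⊗[k] H)) h1).trans ?_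
  rw [mul_assoc]
  rfl

end Expansion

/-! ### The Drinfeld element and the element `t` -/

section Drinfeld

variable {k H : Type*} [Field k] [Ring H] [HopfAlgebra k H]

/-- `S(h₂) u h₁ = ε(h) u`. -/
theorem Quasitriangular.sum_antipode_mul_u_mul (D : Quasitriangular k H) (h : H) {ι : Type*}
    (𝓡 : Repr k h ι) :
    ∑ i ∈ 𝓡.index, antipode k (𝓡.right i) * D.u * 𝓡.left i = counit (R := k) h • D.u := by
  -- `Θ(x ⊗ y) = S(y) x` sends `R` to `u`. The identity is `Θ` applied to `R Δ(h) = Δ^op(h) R`; on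
  -- the right-hand side the factor `S(h₁) h₂` appears in the middle and becomes `ε(h)`.
  let Θ : H ⊗[k] H →ₗ[k] H := antipodeMul k H ∘ₗ (TensorProduct.comm k H H).toLinearMap
  have hΘ : ∀ x y : H, Θ (x ⊗ₜ y) = antipode k y * x := by simp [Θ]
  have hu : Θ D.R = D.u := rfl
  have h1 : ∀ z : H ⊗[k] H, Θ (z * comul (R := k) h) =
      ∑ i ∈ 𝓡.index, antipode k (𝓡.right i) * Θ z * 𝓡.left i := by
    intro z
    rw [← 𝓡.eq]
    induction z with
    | zero => simp
    | add x y hx hy => simp only [add_mul, mul_add, map_add, hx, hy, Finset.sum_add_distrib]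
    | tmul a b => simp [Finset.mul_sum, hΘ, antipode_mul_antidistrib, mul_assoc]
  have h2 : ∀ z : H ⊗[k] H, Θ (TensorProduct.comm k H H (comul (R := k) h) * z) =
      counit (R := k) h • Θ z := by
    intro z
    induction z with
    | zero => simp
    | add x y hx hy => simp only [mul_add, map_add, hx, hy, smul_add]
    | tmul a b =>
      have := sum_antipode_mul_eq_algebraMap_counit (R := k) 𝓡
      rw [← 𝓡.eq]
      simp only [map_sum, TensorProduct.comm_tmul, Finset.sum_mul,
        Algebra.TensorProduct.tmul_mul_tmul, hΘ, antipode_mul_antidistrib]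
      trans antipode k b * (∑ i ∈ 𝓡.index, antipode k (𝓡.left i) * 𝓡.right i) * a
      · simp [Finset.mul_sum, Finset.sum_mul, mul_assoc]
      · rw [this, ← Algebra.commutes, mul_assoc, Algebra.smul_def]
  rw [← hu, ← h1, D.intertwine, h2]

/-- `S²(h) u = u h`. -/
theorem Quasitriangular.antipode_antipode_mul_u (D : Quasitriangular k H) (h : H) :
    antipode k (antipode k h) * D.u = D.u * h := by
  let 𝓡 := Repr.arbitrary k h
  -- The two bracketings of `S²(h₃) S(h₂) u h₁` are compared: `S(h₂) u h₁` collapses by the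
  -- preceding lemma, while `S²(h₃) S(h₂) = S(h₂ S(h₃))` collapses by the antipode axiom.
  let f : H ⊗[k] (H ⊗[k] H) →ₗ[k] H := LinearMap.mul' k H ∘ₗ
    (TensorProduct.map (antipode k ∘ₗ mulAntipode k H) (LinearMap.mulLeft k D.u)) ∘ₗ
    (TensorProduct.comm k H (H ⊗[k] H)).toLinearMap
  have hf : ∀ x y z : H, f (x ⊗ₜ (y ⊗ₜ z)) =
      antipode k (antipode k z) * antipode k y * D.u * x := by
    intro x y z; simp [f, antipode_mul_antidistrib, mul_assoc]
  have hf' : ∀ x : H, ∀ y : H ⊗[k] H, f (x ⊗ₜ y) = antipode k (mulAntipode k H y) * D.u * x := by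
    intro x y; simp [f, mul_assoc]
  have := congrArg f (sum_tmul_tmul_eq (R := k) 𝓡 (fun i => Repr.arbitrary k _)
    (fun i => Repr.arbitrary k _))
  simp only [map_sum, hf] at this
  have h1 : ∀ i, ∑ j ∈ (Repr.arbitrary k (𝓡.left i)).index,
      antipode k (antipode k (𝓡.right i)) * antipode k ((Repr.arbitrary k (𝓡.left i)).right j) *
        D.u * (Repr.arbitrary k (𝓡.left i)).left j =
      counit (R := k) (𝓡.left i) • (antipode k (antipode k (𝓡.right i)) * D.u) := by
    intro i
    rw [← mul_smul_comm, ← D.sum_antipode_mul_u_mul (𝓡.left i) (Repr.arbitrary k _),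
      Finset.mul_sum]
    simp only [mul_assoc]
  have h2 : ∀ i, ∑ j ∈ (Repr.arbitrary k (𝓡.right i)).index,
      antipode k (antipode k ((Repr.arbitrary k (𝓡.right i)).right j)) *
        antipode k ((Repr.arbitrary k (𝓡.right i)).left j) * D.u * 𝓡.left i =
      counit (R := k) (𝓡.right i) • (D.u * 𝓡.left i) := by
    intro i
    have e := congrArg (antipode k) (sum_mul_antipode_eq_algebraMap_counit (R := k)
      (Repr.arbitrary k (𝓡.right i)))
    simp only [map_sum, antipode_mul_antidistrib] at e
    rw [← Finset.sum_mul, ← Finset.sum_mul, e, Algebra.algebraMap_eq_smul_one, map_smul,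
      antipode_one]
    simp
  simp only [h1, h2] at this
  have e1 := congrArg (fun z => antipode k (antipode k (TensorProduct.lid k H z)) * D.u)
    (sum_counit_tmul_eq (R := k) 𝓡)
  have e2 := congrArg (fun z => D.u * (TensorProduct.rid k H z))
    (sum_tmul_counit_eq (R := k) 𝓡)
  simp only [map_sum, TensorProduct.lid_tmul, TensorProduct.rid_tmul, map_smul, one_smul,
    Finset.sum_mul, Finset.mul_sum, smul_mul_assoc, mul_smul_comm] at e1 e2
  rw [← e1, ← e2]
  exact this

variable (D : Ribbon k H)

theorem Ribbon.v_inv_central (h : H) : ((D.v⁻¹ : Hˣ) : H) * h = h * (D.v⁻¹ : Hˣ) :=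
  (Commute.units_inv_left (D.v_central h : Commute (D.v : H) h))

theorem Ribbon.antipode_v_inv : antipode k ((D.v⁻¹ : Hˣ) : H) = (D.v⁻¹ : Hˣ) := by
  refine Units.eq_inv_of_mul_eq_one_left (u := D.v) ?_
  conv_lhs => enter [1]; rw [← D.antipode_v]
  rw [← antipode_mul_antidistrib, Units.inv_mul, antipode_one]

theorem Ribbon.antipode_antipode_mul_t (h : H) :
    antipode k (antipode k h) * D.t = D.t * h := by
  rw [Ribbon.t, ← mul_assoc, D.antipode_antipode_mul_u, mul_assoc, mul_assoc, D.v_inv_central]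

theorem Ribbon.sum_antipode_mul_t_mul (h : H) {ι : Type*} (𝓡 : Repr k h ι) :
    ∑ i ∈ 𝓡.index, antipode k (𝓡.right i) * D.t * 𝓡.left i = counit (R := k) h • D.t := by
  have := congrArg (· * ((D.v⁻¹ : Hˣ) : H)) (D.sum_antipode_mul_u_mul h 𝓡)
  simpa only [Ribbon.t, Finset.sum_mul, smul_mul_assoc, mul_assoc, D.v_inv_central] using this

/-- By `(Δ ⊗ id)(R) = R₁₃ R₂₃` the sum equals `S(∑ b_j t a_j) u`. Here `∑ b_j u a_j = 1`, so `∑ b_j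
t a_j = v⁻¹`, which `S` fixes, and `v⁻¹ u = t`. In the dual `L`-module, `S(t)` comes from the
sovereign structure and `S(b_i)` from the braiding; this is how they merge. -/
theorem Ribbon.sum_antipode_mul_antipode_t {ι : Type*} {s : Finset ι} {a b : ι → H}
    (hR : (D.R : H ⊗[k] H) = ∑ i ∈ s, a i ⊗ₜ b i) (𝓡 : ∀ i, Repr k (a i) (H × H)) :
    ∑ i ∈ s, ∑ j ∈ (𝓡 i).index,
      antipode k ((𝓡 i).right j) * (antipode k D.t * antipode k (b i)) * (𝓡 i).left j = D.t := by
  let N : H ⊗[k] (H ⊗[k] H) →ₗ[k] H := LinearMap.mul' k H ∘ₗ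
    (TensorProduct.comm k H H).toLinearMap ∘ₗ
    TensorProduct.map LinearMap.id (LinearMap.mul' k H ∘ₗ
      TensorProduct.map (antipode k) (LinearMap.mulLeft k (antipode k D.t) ∘ₗ antipode k))
  have hN : ∀ x y z : H, N (x ⊗ₜ (y ⊗ₜ z)) =
      antipode k y * (antipode k D.t * antipode k z) * x := by
    intro x y z; simp [N]
  have h1 := congrArg N D.comul_left
  rw [hR] at h1
  simp only [map_sum, LinearMap.rTensor_tmul, ← (𝓡 _).eq, TensorProduct.sum_tmul,
    TensorProduct.assoc_tmul, hN, Finset.sum_mul_sum] at h1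
  simp only [leg13, leg23, Algebra.TensorProduct.map_tmul, Algebra.TensorProduct.includeRight_apply,
    Algebra.TensorProduct.tmul_mul_tmul, hN, AlgHom.id_apply, one_mul, mul_one,
    antipode_mul_antidistrib] at h1
  rw [h1, Finset.sum_comm]
  have h2 := congrArg (fun z => LinearMap.mul' k H (TensorProduct.comm k H H z))
    (sum_mul_tmul_mul_antipode D.toQuasitriangular hR)
  simp only [map_sum, TensorProduct.comm_tmul, LinearMap.mul'_apply,
    Algebra.TensorProduct.one_def, mul_one] at h2
  have h3 : ∑ j ∈ s, b j * D.u * a j = 1 := by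
    rw [u_eq_sum _ hR, ← h2, Finset.sum_comm]
    simp [Finset.sum_mul, Finset.mul_sum, mul_assoc]
  have h4 : ∑ j ∈ s, b j * D.t * a j = (D.v⁻¹ : Hˣ) := by
    have := congrArg (· * ((D.v⁻¹ : Hˣ) : H)) h3
    simpa only [Ribbon.t, Finset.sum_mul, mul_assoc, D.v_inv_central, one_mul] using this
  trans antipode k (∑ j ∈ s, b j * D.t * a j) * D.u
  · rw [u_eq_sum _ hR]
    simp only [map_sum, Finset.sum_mul_sum, antipode_mul_antidistrib, mul_assoc]
  · rw [h4, D.antipode_v_inv, D.v_inv_central]; rfl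

end Drinfeld

/-! ### Slices `T(w X'') X'` by a trace form `T` -/

section Slice

variable {k H : Type*} [Field k] [Ring H] [HopfAlgebra k H]

/-- The linear map `x ⊗ y ↦ T(w y) x`. -/
def traceSlice (T : H →ₗ[k] k) (w : H) : H ⊗[k] H →ₗ[k] H :=
  (TensorProduct.rid k H).toLinearMap ∘ₗ (T ∘ₗ LinearMap.mulLeft k w).lTensor H

@[simp]
theorem traceSlice_tmul (T : H →ₗ[k] k) (w x y : H) :
    traceSlice T w (x ⊗ₜ y) = T (w * y) • x := by
  simp [traceSlice]

theorem traceSlice_sum (T : H →ₗ[k] k) {ι : Type*} (s : Finset ι) (w : ι → H) (z : H ⊗[k] H) :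
    traceSlice T (∑ i ∈ s, w i) z = ∑ i ∈ s, traceSlice T (w i) z := by
  induction z with
  | zero => simp
  | add x y hx hy => simp only [map_add, hx, hy, Finset.sum_add_distrib]
  | tmul x y => simp [Finset.sum_mul, Finset.sum_smul]

variable {T : H →ₗ[k] k} (hT : ∀ x y, T (x * y) = T (y * x))
include hT

/-- By `sum_antipode_mul_mul_eq` the conjugation moves to the second leg as `h₁ X'' S(h₂)`, and
cyclicity of `T` moves it onto `w`. -/
theorem sum_antipode_mul_traceSlice_mul {X : H ⊗[k] H}
    (hX : ∀ h : H, X * comul (R := k) h = comul (R := k) h * X) (w : H)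
    (h : H) {ι : Type*} (𝓡 : Repr k h ι) :
    ∑ i ∈ 𝓡.index, antipode k (𝓡.left i) * traceSlice T w X * 𝓡.right i =
      traceSlice T (∑ i ∈ 𝓡.index, antipode k (𝓡.right i) * w * 𝓡.left i) X := by
  have e1 : ∀ (x y : H) (z : H ⊗[k] H), traceSlice T w ((x ⊗ₜ 1) * z * (y ⊗ₜ 1)) =
      x * traceSlice T w z * y := by
    intro x y z
    induction z with
    | zero => simp
    | add a b ha hb => simp only [mul_add, add_mul, map_add, ha, hb]
    | tmul a b => simp
  have e2 : ∀ (x y : H) (z : H ⊗[k] H), traceSlice T w ((1 ⊗ₜ x) * z * (1 ⊗ₜ y)) =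
      traceSlice T (y * w * x) z := by
    intro x y z
    induction z with
    | zero => simp
    | add a b ha hb => simp only [mul_add, add_mul, map_add, ha, hb]
    | tmul a b =>
      simp only [Algebra.TensorProduct.tmul_mul_tmul, one_mul, mul_one, traceSlice_tmul]
      rw [← mul_assoc, hT]
      simp only [mul_assoc]
  have := congrArg (traceSlice T w) (sum_antipode_mul_mul_eq X hX h 𝓡)
  simp only [map_sum, e1, e2] at this
  rw [this, traceSlice_sum]

/-- For `w = t` the weight `S(h₂) t h₁` is `ε(h) t`, so the slice `c` satisfies `S(h₁) c h₂ = ε(h)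
c`. Such an element is central. -/
theorem Ribbon.traceSlice_t_central (D : Ribbon k H) {X : H ⊗[k] H}
    (hX : ∀ h : H, X * comul (R := k) h = comul (R := k) h * X) (h : H) :
    h * traceSlice T D.t X = traceSlice T D.t X * h := by
  set c := traceSlice T D.t X
  have hc : ∀ (h : H), LinearMap.mul' k H (TensorProduct.map (antipode k) (LinearMap.mulLeft k c)
      (comul (R := k) h)) = counit (R := k) h • c := by
    intro h
    have := sum_antipode_mul_traceSlice_mul hT hX D.t h (Repr.arbitrary k h)
    rw [D.sum_antipode_mul_t_mul] at this
    rw [← (Repr.arbitrary k h).eq]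
    simp only [map_sum, TensorProduct.map_tmul, LinearMap.mul'_apply, LinearMap.mulLeft_apply,
      ← mul_assoc]
    rw [this]
    have hs : ∀ z : H ⊗[k] H, traceSlice T (counit (R := k) h • D.t) z =
        counit (R := k) h • traceSlice T D.t z := by
      intro z
      induction z with
      | zero => simp
      | add a b ha hb => simp only [map_add, smul_add, ha, hb]
      | tmul a b => simp [mul_smul]
    exact hs X
  -- Both bracketings of `h₁ S(h₂) c h₃` are evaluated: one gives `h c` by `hc`, the other `c h` by
  -- the antipode axiom.
  let f : H ⊗[k] (H ⊗[k] H) →ₗ[k] H := LinearMap.mul' k H ∘ₗ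
    TensorProduct.map LinearMap.id (LinearMap.mul' k H ∘ₗ
      TensorProduct.map (antipode k) (LinearMap.mulLeft k c))
  have h1 := congrArg f (coassoc_apply (R := k) h)
  have h2 : ∀ z : H ⊗[k] H, f ((comul (R := k)).lTensor H z) =
      TensorProduct.rid k H ((counit (R := k)).lTensor H z) * c := by
    intro z
    induction z with
    | zero => simp
    | add a b ha hb => simp only [map_add, add_mul, ha, hb]
    | tmul a b => simp [f, hc]
  have h3 : ∀ z : H ⊗[k] H, f (TensorProduct.assoc k H H H ((comul (R := k)).rTensor H z)) =
      c * TensorProduct.lid k H ((counit (R := k)).rTensor H z) := by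
    have h4 : ∀ (y : H ⊗[k] H) (x : H), f (TensorProduct.assoc k H H H (y ⊗ₜ x)) =
        mulAntipode k H y * c * x := by
      intro y x
      induction y with
      | zero => simp
      | add a b ha hb => simp only [TensorProduct.add_tmul, map_add, add_mul, ha, hb]
      | tmul a b => simp [f, mul_assoc]
    intro z
    induction z with
    | zero => simp
    | add a b ha hb => simp only [map_add, mul_add, ha, hb]
    | tmul a b =>
      rw [LinearMap.rTensor_tmul, h4, ← LinearMap.comp_apply, mulAntipode_comp_comul]
      simp [Algebra.algebraMap_eq_smul_one]
  rw [h2, h3, lTensor_counit_comul, rTensor_counit_comul] at h1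
  simpa using h1.symm

/-- The antipode of the central element `T(t Q'') Q'` is `T(t q'') q'`, where `q = Q⁻¹`. -/
theorem Ribbon.antipode_traceSlice_t (D : Ribbon k H) :
    antipode k (traceSlice T D.t D.Q) =
      traceSlice T D.t ((D.Q⁻¹ : (H ⊗[k] H)ˣ) : H ⊗[k] H) := by
  obtain ⟨s, hR⟩ := TensorProduct.exists_finset (D.R : H ⊗[k] H)
  rw [Q_eq_sum _ hR, inv_Q_eq_sum _ hR]
  simp only [map_sum, traceSlice_tmul, map_smul, antipode_mul_antidistrib]
  refine Finset.sum_congr rfl fun i _ => Finset.sum_congr rfl fun j _ => ?_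
  -- Termwise, `t a_i b_j = S²(a_i) t b_j`, and cyclicity of `T` puts `S²(a_i)` at the end, as in
  -- the expansion of `Q⁻¹`.
  rw [← mul_assoc D.t, ← mul_assoc D.t, ← D.antipode_antipode_mul_t, mul_assoc, hT]

end Slice

/-! ### The coend action through `P₂₁ P` -/

section CoendAction

variable {k A : Type*} [Field k] [Ring A] [Algebra k A]
variable {V : Type*} [AddCommGroup V] [Module k V]

/-- The linear map `x ⊗ y ↦ F(x) y`. -/
def dualSlice (F : Module.Dual k A) : A ⊗[k] A →ₗ[k] A :=
  (TensorProduct.lid k A).toLinearMap ∘ₗ F.rTensor A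

@[simp]
theorem dualSlice_tmul (F : Module.Dual k A) (x y : A) : dualSlice F (x ⊗ₜ y) = F x • y := by
  simp [dualSlice]

/-- The two braiding elements are kept independent so that both can be reduced to pure tensors by
induction; the application has `P' = P`. -/
theorem braiding_braiding_one_tmul (P P' : A ⊗[k] A) (σ : A →ₐ[k] Module.End k V) (v : V) :
    braiding P' σ (regRep k A) (braiding P (regRep k A) σ (1 ⊗ₜ v)) =
      (σ.toLinearMap.flip v).lTensor A (Algebra.TensorProduct.comm k A A P' * P) := by
  induction P with
  | zero => simp [braiding_zero]
  | add x y hx hy => simp only [braiding_add, LinearMap.add_apply, map_add, mul_add, hx, hy]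
  | tmul a b =>
    induction P' with
    | zero => simp [braiding_zero]
    | add x y hx hy => simp only [braiding_add, LinearMap.add_apply, map_add, add_mul, hx, hy]
    | tmul c d => simp [braiding_tmul]

/-- The coend acts on a module through the element `P₂₁ P`. -/
theorem coendAction_tmul (P : A ⊗[k] A) (σ : A →ₐ[k] Module.End k V) (F : Module.Dual k A)
    (v : V) :
    coendAction P σ (F ⊗ₜ v) = σ (dualSlice F (Algebra.TensorProduct.comm k A A P * P)) v := by
  simp only [coendAction, partialMonodromy, monodromyFamily, LinearMap.comp_apply,
    LinearMap.lTensor_tmul, TensorProduct.mk_apply, LinearEquiv.coe_coe,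
    braiding_braiding_one_tmul]
  generalize Algebra.TensorProduct.comm k A A P * P = z
  induction z with
  | zero => simp
  | add x y hx hy =>
    simp only [map_add, TensorProduct.tmul_add, LinearMap.add_apply, hx, hy]
  | tmul a b => simp [coendCounit]

theorem coendCharacter_coendAction (P : A ⊗[k] A) (g : A) (σ : A →ₐ[k] Module.End k V)
    (F : Module.Dual k A) :
    coendCharacter g σ (coendAction P σ) F =
      LinearMap.trace k V (σ (g * dualSlice F (Algebra.TensorProduct.comm k A A P * P))) := by
  simp only [coendCharacter, LinearMap.comp_apply, LinearMap.mulLeft_apply, map_mul]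
  congr 2
  ext v
  simp [coendAction_tmul]

end CoendAction

/-! ### Chiral characters and the dual `L`-module -/

section Chiral

variable {k H : Type*} [Field k] [Ring H] [HopfAlgebra k H]
variable (M : Type*) [AddCommGroup M] [Module k M] [Module H M] [IsScalarTower k H M]

variable (k) in
/-- The trace of the action of an algebra on a module. -/
def moduleTrace {A : Type*} [Ring A] [Algebra k A] (M : Type*) [AddCommGroup M] [Module k M]
    [Module A M] [IsScalarTower k A M] : A →ₗ[k] k :=
  LinearMap.trace k M ∘ₗ (Algebra.lsmul k k M : A →ₐ[k] Module.End k M).toLinearMap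

theorem moduleTrace_apply {A : Type*} [Ring A] [Algebra k A] (M : Type*) [AddCommGroup M]
    [Module k M] [Module A M] [IsScalarTower k A M] (a : A) :
    moduleTrace k M a = LinearMap.trace k M (Algebra.lsmul k k M a) := rfl

theorem moduleTrace_mul_comm {A : Type*} [Ring A] [Algebra k A] (M : Type*) [AddCommGroup M]
    [Module k M] [Module A M] [IsScalarTower k A M] (a b : A) :
    moduleTrace k M (a * b) = moduleTrace k M (b * a) := by
  rw [moduleTrace_apply, moduleTrace_apply, map_mul (Algebra.lsmul k k M),
    map_mul (Algebra.lsmul k k M), LinearMap.trace_mul_comm]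

/-- Exchanges the roles of the two functionals: a trace of an element depending on `F` becomes `F`
evaluated at an element depending on the trace, to which the centrality results apply. -/
theorem apply_mul_dualSlice (T : H →ₗ[k] k) (w : H) (F : Module.Dual k H) (z : H ⊗[k] H) :
    T (w * dualSlice F z) = F (traceSlice T w z) := by
  induction z with
  | zero => simp
  | add x y hx hy => simp only [map_add, mul_add, hx, hy]
  | tmul x y => simp [mul_comm]

theorem chiralCharacter_apply (D : Ribbon k H) (f : Module.Dual k H) :
    chiralCharacter M D f = moduleTrace k M (D.t * dualSlice f D.Q) := by
  rw [chiralCharacter, coendCharacter_coendAction, moduleTrace_apply]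
  rfl

theorem braiding_sum {A U V : Type*} [Ring A] [Algebra k A] [AddCommGroup U] [Module k U]
    [AddCommGroup V] [Module k V] {ι : Type*} (s : Finset ι) (P : ι → A ⊗[k] A)
    (ρ : A →ₐ[k] Module.End k U) (σ : A →ₐ[k] Module.End k V) :
    braiding (∑ i ∈ s, P i) ρ σ = ∑ i ∈ s, braiding (P i) ρ σ := by
  ext; simp [braiding]

theorem coadjointRep_apply (h x : H) (f : Module.Dual k H) {ι : Type*} (𝓡 : Repr k h ι) :
    coadjointRep k H h f x =
      f (∑ i ∈ 𝓡.index, antipode k (𝓡.left i) * x * 𝓡.right i) := by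
  simp only [coadjointRep, AlgHom.comp_apply, Bialgebra.comulAlgHom_apply, ← 𝓡.eq, map_sum,
    LinearMap.sum_apply]
  simp [rightTranslate, Module.Dual.transpose_apply, mul_assoc]

variable [FiniteDimensional k H]

theorem antipodeL_apply (D : Quasitriangular k H) {s : Finset (H × H)}
    (hR : (D.R : H ⊗[k] H) = ∑ i ∈ s, i.1 ⊗ₜ i.2) (f : Module.Dual k H) (h : H) :
    antipodeL D f h = ∑ i ∈ s, ∑ j ∈ s,
      f (antipode k j.1 * antipode k h * antipode k (antipode k i.1) * i.2 * j.2) := by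
  have h1 : ∀ (s : Finset (H × H)) (P : H ⊗[k] H),
      antipodeFamily (∑ i ∈ s, i.1 ⊗ₜ i.2) P (regRep k H) =
        ∑ i ∈ s, antipodeFamily (i.1 ⊗ₜ i.2) P (regRep k H) := by
    classical
    intro s P
    induction s using Finset.induction_on with
    | empty => simp [antipodeFamily, braiding_zero]
    | insert i s hi ih => rw [Finset.sum_insert hi, Finset.sum_insert hi,
        antipodeFamily_add_left, ih]
  have h2 : ∀ (s : Finset (H × H)) (P : H ⊗[k] H),
      antipodeFamily P (∑ i ∈ s, i.1 ⊗ₜ i.2) (regRep k H) =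
        ∑ i ∈ s, antipodeFamily P (i.1 ⊗ₜ i.2) (regRep k H) := by
    classical
    intro s P
    induction s using Finset.induction_on with
    | empty => simp [antipodeFamily, braiding_zero]
    | insert i s hi ih => rw [Finset.sum_insert hi, Finset.sum_insert hi,
        antipodeFamily_add_right, ih]
  rw [antipodeL, hR, h1]
  simp only [h2, LinearMap.comp_apply, LinearMap.flip_apply, TensorProduct.mk_apply,
    LinearMap.sum_apply, antipodeFamily_tmul, regRep_apply, mul_one]

/-- On central elements, `S_L` is the transpose of the antipode. -/
theorem antipodeL_apply_of_central (D : Quasitriangular k H) (f : Module.Dual k H) (c : H)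
    (hc : ∀ h, h * c = c * h) : antipodeL D f c = f (antipode k c) := by
  obtain ⟨s, hR⟩ := TensorProduct.exists_finset (D.R : H ⊗[k] H)
  rw [antipodeL_apply D hR]
  -- Applying `S ⊗ id` and multiplication to `∑ S(a_i) a_j ⊗ b_i b_j = 1` gives `∑ S(a_j) S²(a_i)
  -- b_i b_j = 1`. This is the sum defining `S_L` once `S(c)` is pulled to the front, which is
  -- allowed because `c` commutes with `a_j`.
  have h1 := congrArg (fun z => f (antipode k c * LinearMap.mul' k H z))
    (congrArg ((antipode k).rTensor H) (sum_antipode_mul_tmul_mul D hR))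
  simp only [map_sum, LinearMap.rTensor_tmul, LinearMap.mul'_apply,
    Algebra.TensorProduct.one_def, antipode_one, mul_one, Finset.mul_sum,
    antipode_mul_antidistrib] at h1
  rw [← h1]
  refine Finset.sum_congr rfl fun i _ => Finset.sum_congr rfl fun j _ => ?_
  rw [← antipode_mul_antidistrib, ← hc, antipode_mul_antidistrib]
  simp only [mul_assoc]

/-- On `M^∨` everything acts by transposes: `t` through `S(t)`, and the second leg of the braiding
through `S(b_i)`, while `a_i` acts on `S_L f` coadjointly. The trace of a transpose is the trace of
the original map. -/
theorem chiralDualCharacter_eq_sum [FiniteDimensional k M] (D : Ribbon k H) {s : Finset (H × H)}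
    (hR : (D.R : H ⊗[k] H) = ∑ i ∈ s, i.1 ⊗ₜ i.2) (f : Module.Dual k H) :
    chiralDualCharacter M D f = ∑ i ∈ s, moduleTrace k M ((antipode k D.t * antipode k i.2) *
      dualSlice (coadjointRep k H i.1 (antipodeL D.toQuasitriangular f)) D.Q) := by
  set F := antipodeL D.toQuasitriangular f with hF
  set σ : H →ₐ[k] Module.End k M := Algebra.lsmul k k M
  have h : LinearMap.mulLeft k (dualRep σ D.t)
      (TensorProduct.curry (dualActionL D.toQuasitriangular σ (coendAction (D.R : H ⊗[k] H) σ)) f) =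
      ∑ i ∈ s, Module.Dual.transpose (R := k) (σ (antipode k i.2 *
        dualSlice (coadjointRep k H i.1 F) D.Q * antipode k D.t)) := by
    ext φ m
    simp only [LinearMap.mulLeft_apply, Module.End.mul_apply, TensorProduct.curry_apply,
      dualActionL, LinearMap.comp_apply, LinearMap.rTensor_tmul, ← hF, dualRep_apply]
    rw [hR, braiding_sum]
    simp only [LinearMap.sum_apply, map_sum, braiding_tmul, TensorProduct.lift.tmul,
      LinearMap.flip_apply, LinearMap.comp_apply, Module.Dual.transpose_apply,
      TensorProduct.curry_apply, ← hR, coendAction_tmul, dualRep_apply, map_mul,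
      Module.End.mul_apply]
    rfl
  rw [chiralDualCharacter, coendCharacter, LinearMap.comp_apply, LinearMap.comp_apply, h, map_sum]
  refine Finset.sum_congr rfl fun i _ => ?_
  rw [LinearMap.trace_transpose', ← moduleTrace_apply, moduleTrace_mul_comm, mul_assoc]

/-- The coadjoint action of `a_i` conjugates the slice of `Q`, and `sum_antipode_mul_traceSlice_mul`
transfers this to the weight. The total weight is `t`, so the dual character is `S_L f` at a central
element, that is, `f` at its antipode, a slice of `Q⁻¹`. -/
theorem chiralDualCharacter_apply [FiniteDimensional k M] (D : Ribbon k H)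
    (f : Module.Dual k H) :
    chiralDualCharacter M D f =
      moduleTrace k M (D.t * dualSlice f ((D.Q⁻¹ : (H ⊗[k] H)ˣ) : H ⊗[k] H)) := by
  obtain ⟨s, hR⟩ := TensorProduct.exists_finset (D.R : H ⊗[k] H)
  have hT := moduleTrace_mul_comm (k := k) (A := H) M
  have hQ := D.Q_mul_comul
  have ht := D.sum_antipode_mul_antipode_t (a := Prod.fst) (b := Prod.snd) hR
    (fun i => Repr.arbitrary k i.1)
  rw [chiralDualCharacter_eq_sum M D hR, apply_mul_dualSlice, ← Ribbon.antipode_traceSlice_t hT D,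
    ← antipodeL_apply_of_central D.toQuasitriangular f _ (Ribbon.traceSlice_t_central hT D hQ),
    ← congrArg (fun w => antipodeL D.toQuasitriangular f (traceSlice (moduleTrace k M) w D.Q)) ht,
    traceSlice_sum, map_sum]
  refine Finset.sum_congr rfl fun i _ => ?_
  rw [apply_mul_dualSlice, coadjointRep_apply _ _ _ (Repr.arbitrary k i.1),
    sum_antipode_mul_traceSlice_mul hT hQ]

end Chiral

/-! ### The bulk character as a trace over `X` -/

section Bulk

variable {k H : Type*} [Field k] [Ring H] [HopfAlgebra k H]

/-- On the left legs `R⁻¹ R₂₁⁻¹ = Q⁻¹`. On the right legs the product is taken in `H^op`, so `R`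
times `R₂₁` there is `R₂₁ R = Q`. -/
theorem comm_bulkBraidingElement_mul (D : Quasitriangular k H) :
    Algebra.TensorProduct.comm k _ _ (bulkBraidingElement D) * bulkBraidingElement D =
      TensorProduct.tensorTensorTensorComm k H H Hᵐᵒᵖ Hᵐᵒᵖ
        (((D.Q⁻¹ : (H ⊗[k] H)ˣ) : H ⊗[k] H) ⊗ₜ[k]
          TensorProduct.map (MulOpposite.opLinearEquiv k).toLinearMap
            (MulOpposite.opLinearEquiv k).toLinearMap (D.Q : H ⊗[k] H)) := by
  have h1 : ∀ x y z w : H ⊗[k] H, Algebra.TensorProduct.comm k _ _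
      (TensorProduct.tensorTensorTensorComm k H H Hᵐᵒᵖ Hᵐᵒᵖ
        (x ⊗ₜ[k] TensorProduct.map (MulOpposite.opLinearEquiv k).toLinearMap
            (MulOpposite.opLinearEquiv k).toLinearMap y)) *
      (TensorProduct.tensorTensorTensorComm k H H Hᵐᵒᵖ Hᵐᵒᵖ
        (z ⊗ₜ[k] TensorProduct.map (MulOpposite.opLinearEquiv k).toLinearMap
            (MulOpposite.opLinearEquiv k).toLinearMap w)) =
      TensorProduct.tensorTensorTensorComm k H H Hᵐᵒᵖ Hᵐᵒᵖ
        ((Algebra.TensorProduct.comm k H H x * z) ⊗ₜ[k]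
          TensorProduct.map (MulOpposite.opLinearEquiv k).toLinearMap
            (MulOpposite.opLinearEquiv k).toLinearMap (w * Algebra.TensorProduct.comm k H H y)) := by
    intro x y z w
    induction x with
    | zero => simp
    | add x x' hx hx' => simp only [map_add, add_mul, TensorProduct.add_tmul, hx, hx']
    | tmul a b =>
    induction z with
    | zero => simp
    | add x x' hx hx' => simp only [map_add, mul_add, TensorProduct.add_tmul, hx, hx']
    | tmul c d =>
    induction y with
    | zero => simp
    | add x x' hx hx' => simp only [map_add, add_mul, mul_add, TensorProduct.tmul_add, hx, hx']
    | tmul a' b' =>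
    induction w with
    | zero => simp
    | add x x' hx hx' => simp only [map_add, add_mul, mul_add, TensorProduct.tmul_add, hx, hx']
    | tmul c' d' => simp
  have h2 : ∀ x : H ⊗[k] H,
      Algebra.TensorProduct.comm k H H (Algebra.TensorProduct.comm k H H x) = x :=
    (TensorProduct.comm k H H).symm_apply_apply
  have h3 : (D.R21 : H ⊗[k] H) = Algebra.TensorProduct.comm k H H D.R := rfl
  have h4 : ((D.R21⁻¹ : (H ⊗[k] H)ˣ) : H ⊗[k] H) =
      Algebra.TensorProduct.comm k H H ((D.R⁻¹ : (H ⊗[k] H)ˣ) : H ⊗[k] H) := by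
    rw [Quasitriangular.R21, ← map_inv]; rfl
  rw [bulkBraidingElement, h1, Quasitriangular.Q, mul_inv_rev, Units.val_mul, Units.val_mul, h4,
    h2, h3, h2]

theorem bulkCharacter_tmul [FiniteDimensional k H] (D : Ribbon k H) (X : Type*) [AddCommGroup X]
    [Module k X] [Module (H ⊗[k] Hᵐᵒᵖ) X] [IsScalarTower k (H ⊗[k] Hᵐᵒᵖ) X]
    (f g : Module.Dual k H) :
    bulkCharacter D X (f ⊗ₜ g) = moduleTrace k X
      ((D.t * dualSlice f ((D.Q⁻¹ : (H ⊗[k] H)ˣ) : H ⊗[k] H)) ⊗ₜ[k]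
        MulOpposite.op (dualSlice g (D.Q : H ⊗[k] H) * D.t)) := by
  rw [bulkCharacter, LinearMap.comp_apply, LinearEquiv.coe_coe, coendCharacter_coendAction,
    comm_bulkBraidingElement_mul, moduleTrace_apply]
  congr 2
  generalize (D.Q⁻¹ : (H ⊗[k] H)ˣ).val = x
  generalize D.Q.val = y
  have : dualSlice (bulkIdent k H (f ⊗ₜ g)) (TensorProduct.tensorTensorTensorComm k H H Hᵐᵒᵖ Hᵐᵒᵖ
        (x ⊗ₜ[k] TensorProduct.map (MulOpposite.opLinearEquiv k).toLinearMap
            (MulOpposite.opLinearEquiv k).toLinearMap y)) =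
      dualSlice f x ⊗ₜ[k] MulOpposite.op (dualSlice g y) := by
    induction x with
    | zero => simp
    | add x x' hx hx' => simp only [map_add, TensorProduct.add_tmul, hx, hx']
    | tmul a b =>
    induction y with
    | zero => simp
    | add x x' hx hx' => simp only [map_add, TensorProduct.tmul_add, MulOpposite.op_add, hx, hx']
    | tmul c d => simp [bulkIdent_apply, TensorProduct.smul_tmul', TensorProduct.tmul_smul, mul_smul,
        smul_comm (f a)]
  rw [this]
  simp

end Bulk

/-! ### Traces and Jordan–Hölder multiplicities -/

section TraceAdditivity

theorem trace_eq_add_of_exact {k P V Q : Type*} [Field k] [AddCommGroup P] [Module k P]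
    [AddCommGroup V] [Module k V] [AddCommGroup Q] [Module k Q]
    [FiniteDimensional k P] [FiniteDimensional k V] [FiniteDimensional k Q]
    (i : P →ₗ[k] V) (p : V →ₗ[k] Q) (hi : Function.Injective i) (hp : Function.Surjective p)
    (hex : Function.Exact i p) (f : V →ₗ[k] V) (g : P →ₗ[k] P) (h : Q →ₗ[k] Q)
    (hg : f ∘ₗ i = i ∘ₗ g) (hh : p ∘ₗ f = h ∘ₗ p) :
    LinearMap.trace k V f = LinearMap.trace k P g + LinearMap.trace k Q h := by
  obtain ⟨r, hr⟩ := i.exists_leftInverse_of_injective (LinearMap.ker_eq_bot.mpr hi)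
  obtain ⟨s, hs⟩ := p.exists_rightInverse_of_surjective (LinearMap.range_eq_top.mpr hp)
  have hpi : p ∘ₗ i = 0 := hex.linearMap_comp_eq_zero
  -- Retraction `r` and section `s` are chosen independently; subtracting `i r s` makes the section
  -- compatible with `r`, so that the two projections sum to the identity. Cyclicity of the trace
  -- then handles each summand of `f`.
  have hid : i ∘ₗ r + (s - i ∘ₗ r ∘ₗ s) ∘ₗ p = LinearMap.id := by
    ext x
    have hx : p (x - s (p x)) = 0 := by
      rw [map_sub, sub_eq_zero]; exact (LinearMap.congr_fun hs (p x)).symm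
    obtain ⟨y, hy⟩ := (hex _).mp hx
    have e : i (r (i y)) = i y := congrArg i (LinearMap.congr_fun hr y)
    rw [hy, map_sub, map_sub, sub_eq_iff_eq_add] at e
    simp only [LinearMap.add_apply, LinearMap.comp_apply, LinearMap.sub_apply, LinearMap.id_apply,
      e]
    abel
  have h1 : f = (f ∘ₗ i) ∘ₗ r + (f ∘ₗ (s - i ∘ₗ r ∘ₗ s)) ∘ₗ p := by
    conv_lhs => rw [← LinearMap.comp_id f, ← hid]
    rw [LinearMap.comp_add]; rfl
  have h2 : p ∘ₗ (s - i ∘ₗ r ∘ₗ s) = LinearMap.id := by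
    rw [LinearMap.comp_sub, hs, ← LinearMap.comp_assoc, hpi]; simp
  have e1 : LinearMap.trace k V ((f ∘ₗ i) ∘ₗ r) = LinearMap.trace k P g := by
    rw [LinearMap.trace_comp_comm', hg, ← LinearMap.comp_assoc, hr, LinearMap.id_comp]
  have e2 : LinearMap.trace k V ((f ∘ₗ (s - i ∘ₗ r ∘ₗ s)) ∘ₗ p) = LinearMap.trace k Q h := by
    rw [LinearMap.trace_comp_comm', ← LinearMap.comp_assoc, hh, LinearMap.comp_assoc, h2,
      LinearMap.comp_id]
  rw [h1, map_add, e1, e2]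

variable {k A : Type*} [Field k] [Ring A] [Algebra k A]

theorem moduleTrace_congr {M N : Type*} [AddCommGroup M] [Module k M] [Module A M]
    [IsScalarTower k A M] [AddCommGroup N] [Module k N] [Module A N] [IsScalarTower k A N]
    (e : M ≃ₗ[A] N) (a : A) : moduleTrace k M a = moduleTrace k N a := by
  rw [moduleTrace_apply, moduleTrace_apply, ← LinearMap.trace_conj' _ (e.restrictScalars k)]
  congr 1
  ext x
  simp [LinearEquiv.conj_apply]

variable {X : Type*} [AddCommGroup X] [Module k X] [Module A X] [IsScalarTower k A X]
  [FiniteDimensional k X]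

theorem finiteDimensional_submodule (P : Submodule A X) : FiniteDimensional k P :=
  inferInstanceAs (FiniteDimensional k (P.restrictScalars k))

theorem finiteDimensional_quotient (P : Submodule A X) : FiniteDimensional k (X ⧸ P) :=
  Module.Finite.of_surjective (P.mkQ.restrictScalars k) P.mkQ_surjective

theorem moduleTrace_eq_add (P : Submodule A X) (a : A) :
    moduleTrace k X a = moduleTrace k P a + moduleTrace k (X ⧸ P) a := by
  have := finiteDimensional_submodule (k := k) P
  have := finiteDimensional_quotient (k := k) P
  refine trace_eq_add_of_exact (P.subtype.restrictScalars k) (P.mkQ.restrictScalars k)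
    P.injective_subtype P.mkQ_surjective ?_ _ _ _ ?_ ?_
  · exact LinearMap.exact_subtype_mkQ P
  · ext; simp
  · ext; simp

theorem moduleTrace_submodule_eq_add {N N' : Submodule A X} (h : N ≤ N') (a : A) :
    moduleTrace k N' a =
      moduleTrace k N a + moduleTrace k (N' ⧸ N.submoduleOf N') a := by
  have := finiteDimensional_submodule (k := k) N'
  rw [moduleTrace_eq_add (N.submoduleOf N') a,
    moduleTrace_congr (Submodule.submoduleOfEquivOfLe h)]

theorem sum_succ_sub_castSucc {n : ℕ} (g : Fin (n + 1) → k) :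
    ∑ m : Fin n, (g m.succ - g m.castSucc) = g (Fin.last n) - g 0 := by
  induction n with
  | zero => simp
  | succ n ih =>
    rw [Fin.sum_univ_castSucc]
    have := ih (fun m => g m.castSucc)
    simp only [← Fin.succ_castSucc] at this ⊢
    rw [this]
    simp

/-- The trace of the action is the sum of its traces on the factors of a composition series. -/
theorem moduleTrace_eq_sum_factors (s : CompositionSeries (Submodule A X)) (h0 : s.head = ⊥)
    (h1 : s.last = ⊤) (a : A) :
    moduleTrace k X a = ∑ m : Fin s.length,
      moduleTrace k (s m.succ ⧸ (s m.castSucc).submoduleOf (s m.succ)) a := by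
  -- Each factor contributes the difference of the traces on consecutive submodules, so the sum
  -- telescopes to the trace on `⊤` minus that on `⊥`.
  have h2 : ∀ m : Fin s.length,
      moduleTrace k (s m.succ ⧸ (s m.castSucc).submoduleOf (s m.succ)) a =
        moduleTrace k (s m.succ) a - moduleTrace k (s m.castSucc) a := by
    intro m
    rw [moduleTrace_submodule_eq_add (k := k) (s.strictMono.monotone m.castSucc_lt_succ.le)]
    ring
  rw [Finset.sum_congr rfl fun m _ => h2 m,
    sum_succ_sub_castSucc (fun m => moduleTrace k (s m) a)]
  have e1 : moduleTrace k (s (Fin.last _)) a = moduleTrace k X a := by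
    have : s (Fin.last _) = ⊤ := h1
    rw [this]
    exact moduleTrace_congr Submodule.topEquiv a
  have e0 : moduleTrace k (s 0) a = 0 := by
    have : s 0 = ⊥ := h0
    rw [this, moduleTrace_apply]
    have : (Algebra.lsmul k k (⊥ : Submodule A X) a) = 0 := by
      ext x
    rw [this, map_zero]
  rw [e1, e0, sub_zero]

theorem isSimpleModule_factor (s : CompositionSeries (Submodule A X)) (m : Fin s.length) :
    IsSimpleModule A (s m.succ ⧸ (s m.castSucc).submoduleOf (s m.succ)) :=
  (covBy_iff_quot_is_simple (s.strictMono.monotone m.castSucc_lt_succ.le)).mp (s.step m)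

open Classical in
/-- If `Y i` represents each isomorphism class of simple modules exactly once, then the trace is the
sum of the traces on the `Y i`, weighted by the Jordan–Hölder multiplicities. -/
theorem moduleTrace_eq_sum_jhMultiplicity {k A : Type*} [Field k] [Ring A] [Algebra k A]
    (X : Type u) [AddCommGroup X] [Module k X] [Module A X] [IsScalarTower k A X]
    [FiniteDimensional k X] {ι : Type*} [Fintype ι] (Y : ι → Type*)
    [∀ i, AddCommGroup (Y i)] [∀ i, Module k (Y i)] [∀ i, Module A (Y i)]
    [∀ i, IsScalarTower k A (Y i)]
    (hinj : ∀ i j, Nonempty (Y i ≃ₗ[A] Y j) → i = j)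
    (hfull : ∀ (Z : Type u) [AddCommGroup Z] [Module k Z] [Module A Z] [IsScalarTower k A Z]
      [FiniteDimensional k Z], IsSimpleModule A Z → ∃ i, Nonempty (Z ≃ₗ[A] Y i)) (a : A) :
    moduleTrace k X a = ∑ i, jhMultiplicity A X (Y i) • moduleTrace k (Y i) a := by
  have : IsNoetherian A X := isNoetherian_of_tower k inferInstance
  have : IsArtinian A X := isArtinian_of_tower k inferInstance
  obtain ⟨s, h0, h1⟩ := exists_jhSeries A (X := X)
  rw [moduleTrace_eq_sum_factors s h0 h1 a]
  have hfactor : ∀ m : Fin s.length, ∃ i, FactorIso A (Y i) s m := by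
    intro m
    have := finiteDimensional_submodule (k := k) (s m.succ)
    have := finiteDimensional_quotient (k := k) ((s m.castSucc).submoduleOf (s m.succ))
    exact hfull (s m.succ ⧸ (s m.castSucc).submoduleOf (s m.succ)) (isSimpleModule_factor s m)
  -- `t m` labels the isomorphism type of the `m`-th factor. By `hinj` the multiplicity of `Y i` is
  -- the size of the fibre of `t` over `i`.
  choose t ht using hfactor
  have e : ∀ i, jhMultiplicity A X (Y i) = (Finset.univ.filter fun m => t m = i).card := by
    intro i
    rw [jhMultiplicity_eq A (Y i) s h0 h1, factorCount, Nat.card_eq_fintype_card,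
      Fintype.card_subtype]
    congr 1
    ext m
    simp only [Finset.mem_filter, Finset.mem_univ, true_and]
    constructor
    · rintro ⟨f⟩
      obtain ⟨f'⟩ := ht m
      exact hinj _ _ ⟨f'.symm.trans f⟩
    · rintro rfl
      exact ht m
  have e2 : ∀ m, moduleTrace k (s m.succ ⧸ (s m.castSucc).submoduleOf (s m.succ)) a =
      moduleTrace k (Y (t m)) a := by
    intro m
    obtain ⟨f⟩ := ht m
    exact moduleTrace_congr f a
  rw [Finset.sum_congr rfl fun m _ => e2 m, ← Finset.sum_fiberwise Finset.univ t]
  refine Finset.sum_congr rfl fun i _ => ?_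
  rw [e, ← Finset.sum_const]
  exact Finset.sum_congr rfl fun m hm => by rw [(Finset.mem_filter.mp hm).2]

end TraceAdditivity

/-! ### Classification of simple bimodules -/

section SimpleBimodules

/-- Burnside's theorem. -/
theorem exists_smul_eq_of_isSimpleModule {k H S : Type*} [Field k] [IsAlgClosed k] [Ring H]
    [Algebra k H] [AddCommGroup S] [Module k S] [Module H S] [IsScalarTower k H S]
    [FiniteDimensional k S] [IsSimpleModule H S] (φ : Module.End k S) :
    ∃ h : H, ∀ x : S, h • x = φ x := by
  have hend := IsSimpleModule.algebraMap_end_bijective_of_isAlgClosed (A := H) (V := S) k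
  -- By Schur's lemma `End_H(S) = k`, so every `k`-linear `φ` lies in the bicommutant; the density
  -- theorem then realises it by an element of `H`.
  let f : Module.End (Module.End H S) S :=
    { toFun := φ
      map_add' := φ.map_add
      map_smul' := by
        intro e x
        obtain ⟨c, rfl⟩ := hend.2 e
        simp }
  have : Module.Finite (Module.End H S) S := by
    refine Module.Finite.of_restrictScalars_finite k _ _
  obtain ⟨h, hh⟩ := Module.Finite.toModuleEnd_moduleEnd_surjective (R := H) f
  exact ⟨h, fun x => LinearMap.congr_fun hh x⟩

theorem finiteDimensional_of_isSimpleModule (k H S : Type*) [Field k] [Ring H]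
    [Algebra k H] [FiniteDimensional k H] [AddCommGroup S] [Module k S] [Module H S]
    [IsScalarTower k H S] [IsSimpleModule H S] : FiniteDimensional k S := by
  have : Nontrivial S := IsSimpleModule.nontrivial H S
  obtain ⟨x, hx⟩ := exists_ne (0 : S)
  exact Module.Finite.of_surjective ((LinearMap.toSpanSingleton H S x).restrictScalars k)
    (IsSimpleModule.toSpanSingleton_surjective H hx)

variable {k H : Type*} [Field k] [Ring H] [HopfAlgebra k H]

/-! ### The bimodule `S ⊗ T^*`: its trace and its full endomorphism algebra -/

section Outer

variable (S T : Type*) [AddCommGroup S] [Module k S] [Module H S] [IsScalarTower k H S]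
  [AddCommGroup T] [Module k T] [Module H T] [IsScalarTower k H T]

instance : Module k (OuterBimodule k S T) :=
  inferInstanceAs (Module k (S ⊗[k] Module.Dual k T))

instance [FiniteDimensional k S] [FiniteDimensional k T] :
    FiniteDimensional k (OuterBimodule k S T) :=
  inferInstanceAs (FiniteDimensional k (S ⊗[k] Module.Dual k T))

theorem outerBimodule_smul_def (h h' : H) (w : OuterBimodule k S T) :
    (h ⊗ₜ[k] MulOpposite.op h') • w =
      TensorProduct.map (Algebra.lsmul k k S h)
        (Module.Dual.transpose (R := k) (Algebra.lsmul k k T h')) w := rfl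

instance : IsScalarTower k (H ⊗[k] Hᵐᵒᵖ) (OuterBimodule k S T) where
  smul_assoc c a w := by
    change ((Module.endTensorEndAlgHom (R := k) (S := k) (A := k)).comp
      (Algebra.TensorProduct.map (Algebra.lsmul k k S : H →ₐ[k] Module.End k S)
        (opDualRep k H T))) (c • a) w = c • ((Module.endTensorEndAlgHom (R := k) (S := k)
        (A := k)).comp (Algebra.TensorProduct.map (Algebra.lsmul k k S : H →ₐ[k] Module.End k S)
        (opDualRep k H T))) a w
    rw [map_smul]; rfl

/-- `S ⊗ T^* ≃ Hom(T, S)`. -/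
def outerHomEquiv [FiniteDimensional k T] : OuterBimodule k S T ≃ₗ[k] (T →ₗ[k] S) :=
  TensorProduct.comm k S (Module.Dual k T) ≪≫ₗ dualTensorHomEquiv k T S

theorem outerHomEquiv_tmul [FiniteDimensional k T] (s : S) (φ : Module.Dual k T) (x : T) :
    outerHomEquiv S T (show OuterBimodule k S T from s ⊗ₜ[k] φ) x = φ x • s :=
  dualTensorHom_apply φ x s

/-- Maps into or out of `S ⊗ T^*` are handled below in the model `Hom(T, S)`, where equality can be
checked pointwise. -/
theorem outerHomEquiv_smul [FiniteDimensional k T] (h h' : H) (w : OuterBimodule k S T) (x : T) :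
    outerHomEquiv S T ((h ⊗ₜ[k] MulOpposite.op h') • w) x =
      h • outerHomEquiv S T w (h' • x) := by
  rw [outerBimodule_smul_def]
  have : ∀ w : S ⊗[k] Module.Dual k T, outerHomEquiv S T (show OuterBimodule k S T from
      TensorProduct.map (Algebra.lsmul k k S h)
        (Module.Dual.transpose (R := k) (Algebra.lsmul k k T h')) w) x =
      h • outerHomEquiv S T (show OuterBimodule k S T from w) (h' • x) := by
    intro w
    induction w with
    | zero =>
      rw [map_zero]
      change (outerHomEquiv S T 0) x = h • (outerHomEquiv S T 0) (h' • x)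
      simp
    | add a b ha hb =>
      rw [map_add]
      change (outerHomEquiv S T ((show OuterBimodule k S T from _) +
        (show OuterBimodule k S T from _))) x = h • (outerHomEquiv S T
          ((show OuterBimodule k S T from a) + (show OuterBimodule k S T from b))) (h' • x)
      rw [map_add, map_add, LinearMap.add_apply, LinearMap.add_apply, smul_add]
      exact congrArg₂ _ ha hb
    | tmul s φ =>
      rw [TensorProduct.map_tmul, outerHomEquiv_tmul, outerHomEquiv_tmul]
      simp [Module.Dual.transpose_apply, smul_comm h]
  exact this w

theorem moduleTrace_outerBimodule [FiniteDimensional k S] [FiniteDimensional k T] (h h' : H) :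
    moduleTrace k (OuterBimodule k S T) (h ⊗ₜ[k] MulOpposite.op h') =
      moduleTrace k S h * moduleTrace k T h' := by
  rw [moduleTrace_apply, moduleTrace_apply, moduleTrace_apply,
    ← LinearMap.trace_transpose' (Algebra.lsmul k k T h'), ← LinearMap.trace_tensorProduct']
  rfl

variable [IsAlgClosed k] [FiniteDimensional k S] [FiniteDimensional k T]
  [IsSimpleModule H S] [IsSimpleModule H T]

-- Burnside's theorem on both factors, together with `End(S ⊗ T^*) = End(S) ⊗ End(T^*)`.
variable (H) in
theorem exists_smul_eq_outerBimodule (φ : Module.End k (S ⊗[k] Module.Dual k T)) :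
    ∃ a : H ⊗[k] Hᵐᵒᵖ, ∀ w : OuterBimodule k S T, a • w = φ w := by
  obtain ⟨z, rfl⟩ := (homTensorHomEquiv k S (Module.Dual k T) S (Module.Dual k T)).surjective φ
  induction z with
  | zero =>
    refine ⟨0, fun w => (zero_smul (H ⊗[k] Hᵐᵒᵖ) w).trans ?_⟩
    have := LinearMap.congr_fun (map_zero (homTensorHomEquiv k S (Module.Dual k T) S
      (Module.Dual k T))) w
    exact this.symm
  | add x y hx hy =>
    obtain ⟨a, ha⟩ := hx
    obtain ⟨b, hb⟩ := hy
    exact ⟨a + b, fun w => by rw [add_smul, ha, hb, map_add]; rfl⟩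
  | tmul α β =>
    obtain ⟨h, hh⟩ := exists_smul_eq_of_isSimpleModule (H := H) α
    -- `γ` is the endomorphism of `T` with transpose `β`, available because `T` is reflexive.
    -- Burnside's theorem can thus be used for `T` itself.
    let γ : Module.End k T := (Module.evalEquiv k T).symm.toLinearMap ∘ₗ
      Module.Dual.transpose (R := k) β ∘ₗ (Module.evalEquiv k T).toLinearMap
    have hγ : ∀ (χ : Module.Dual k T) (x : T), χ (γ x) = β χ x := by
      intro χ x
      have : Module.evalEquiv k T (γ x) χ = β χ x := by
        simp only [γ, LinearMap.comp_apply, LinearEquiv.coe_coe, LinearEquiv.apply_symm_apply]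
        rfl
      simpa using this
    obtain ⟨h', hh'⟩ := exists_smul_eq_of_isSimpleModule (H := H) γ
    refine ⟨h ⊗ₜ MulOpposite.op h', fun w => ?_⟩
    rw [outerBimodule_smul_def]
    have e1 : Algebra.lsmul k k S h = α := by ext x; exact hh x
    have e2 : Module.Dual.transpose (R := k) (Algebra.lsmul k k T h') = β := by
      ext χ x
      change χ (h' • x) = _
      rw [hh', hγ]
    rw [e1, e2]
    rw [homTensorHomEquiv_apply]
    rfl

/-- A rank-one endomorphism takes `w` to `y`, and every endomorphism comes from the algebra. This is
simplicity of `S ⊗ T^*` in the form used for surjectivity. -/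
theorem exists_smul_eq_of_ne_zero {w : OuterBimodule k S T} (hw : w ≠ 0)
    (y : OuterBimodule k S T) : ∃ a : H ⊗[k] Hᵐᵒᵖ, a • w = y := by
  obtain ⟨f, hf⟩ := Module.Projective.exists_dual_ne_zero k hw
  obtain ⟨a, ha⟩ := exists_smul_eq_outerBimodule H S T ((f w)⁻¹ • f.smulRight y)
  refine ⟨a, (ha w).trans ?_⟩
  change (f w)⁻¹ • f w • y = y
  rw [smul_smul, inv_mul_cancel₀ hf, one_smul]

end Outer

/-! ### `S ⊗ T^*` determines `S` and `T` -/

section Uniqueness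

variable {S T S' T' : Type*} [AddCommGroup S] [Module k S] [Module H S] [IsScalarTower k H S]
  [AddCommGroup T] [Module k T] [Module H T] [IsScalarTower k H T]
  [AddCommGroup S'] [Module k S'] [Module H S'] [IsScalarTower k H S']
  [AddCommGroup T'] [Module k T'] [Module H T'] [IsScalarTower k H T']
  [FiniteDimensional k T] [FiniteDimensional k T']
  [IsSimpleModule H S] [IsSimpleModule H T] [IsSimpleModule H S'] [IsSimpleModule H T']

/-- Read in `Hom(T', S')`, the isomorphism becomes a nonzero map `E s φ x` that is equivariant in
`s` and balanced between `φ` and `x`. Freezing the other arguments gives nonzero homomorphisms `S →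
S'` and `T' → T`, isomorphisms by Schur's lemma. The second arrow is reversed because `T` enters
through its dual. -/
theorem nonempty_equiv_of_outerBimodule_equiv
    (e : OuterBimodule k S T ≃ₗ[H ⊗[k] Hᵐᵒᵖ] OuterBimodule k S' T') :
    Nonempty (S ≃ₗ[H] S') ∧ Nonempty (T' ≃ₗ[H] T) := by
  have : Nontrivial S := IsSimpleModule.nontrivial H S
  have : Nontrivial T := IsSimpleModule.nontrivial H T
  obtain ⟨s₀, hs₀⟩ := exists_ne (0 : S)
  obtain ⟨φ₀, hφ₀⟩ := exists_ne (0 : Module.Dual k T)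
  obtain ⟨x₀, hx₀⟩ : ∃ x, φ₀ x ≠ 0 := by
    by_contra! h
    exact hφ₀ (LinearMap.ext h)
  let E : S → Module.Dual k T → (T' →ₗ[k] S') := fun s φ =>
    outerHomEquiv S' T' (e (show OuterBimodule k S T from s ⊗ₜ[k] φ))
  have hE : ∀ (h h' : H) s φ x, E (h • s) (φ ∘ₗ Algebra.lsmul k k T h') x = h • E s φ (h' • x) := by
    intro h h' s φ x
    change outerHomEquiv S' T' (e ((h ⊗ₜ[k] MulOpposite.op h') •
      (show OuterBimodule k S T from s ⊗ₜ[k] φ))) x = _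
    rw [map_smul, outerHomEquiv_smul]
  have hE1 : ∀ (h : H) s φ x, E (h • s) φ x = h • E s φ x := by
    intro h s φ x
    have := hE h 1 s φ x
    rwa [map_one, one_smul, Module.End.one_eq_id, LinearMap.comp_id] at this
  have hE2 : ∀ (h' : H) s φ x, E s (φ ∘ₗ Algebra.lsmul k k T h') x = E s φ (h' • x) := by
    intro h' s φ x
    have := hE 1 h' s φ x
    rwa [one_smul, one_smul] at this
  have hadd : ∀ a b : OuterBimodule k S T, outerHomEquiv S' T' (e (a + b)) =
      outerHomEquiv S' T' (e a) + outerHomEquiv S' T' (e b) := by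
    intro a b; rw [map_add, map_add]
  have hsm : ∀ (c : k) (a : OuterBimodule k S T), outerHomEquiv S' T' (e (c • a)) =
      c • outerHomEquiv S' T' (e a) := by
    intro c a
    rw [← LinearEquiv.restrictScalars_apply k e, map_smul, map_smul]; rfl
  have hEa1 : ∀ s s' φ, E (s + s') φ = E s φ + E s' φ := by
    intro s s' φ
    rw [← hadd]
    exact congrArg (fun w => outerHomEquiv S' T' (e w)) (TensorProduct.add_tmul s s' φ)
  have hEa2 : ∀ s φ φ', E s (φ + φ') = E s φ + E s φ' := by
    intro s φ φ'
    rw [← hadd]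
    exact congrArg (fun w => outerHomEquiv S' T' (e w)) (TensorProduct.tmul_add s φ φ')
  have hEs2 : ∀ s (c : k) φ, E s (c • φ) = c • E s φ := by
    intro s c φ
    rw [← hsm]
    exact congrArg (fun w => outerHomEquiv S' T' (e w)) (TensorProduct.tmul_smul c s φ)
  have hne : E s₀ φ₀ ≠ 0 := by
    intro h0
    have h1 : (show OuterBimodule k S T from s₀ ⊗ₜ[k] φ₀) = 0 := by
      apply e.injective
      apply (outerHomEquiv S' T').injective
      rw [map_zero, map_zero]
      exact h0
    have h2 := outerHomEquiv_tmul S T s₀ φ₀ x₀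
    rw [h1, map_zero, LinearMap.zero_apply] at h2
    exact (smul_ne_zero hx₀ hs₀) h2.symm
  obtain ⟨x, hx⟩ : ∃ x, E s₀ φ₀ x ≠ 0 := by
    by_contra! h
    exact hne (LinearMap.ext h)
  constructor
  · let f : S →ₗ[H] S' :=
      { toFun := fun s => E s φ₀ x
        map_add' := fun s s' => by rw [hEa1]; rfl
        map_smul' := fun h s => hE1 h s φ₀ x }
    have hf : f ≠ 0 := fun h => hx (LinearMap.congr_fun h s₀)
    exact ⟨LinearEquiv.ofBijective f (LinearMap.bijective_of_ne_zero hf)⟩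
  · obtain ⟨ξ, hξ⟩ := Module.Projective.exists_dual_ne_zero k hx
    -- With `s₀` and a functional `ξ` on `S'` fixed, `φ ↦ ξ (E s₀ φ x')` is an element of the double
    -- dual `T^{**}`, which is identified with `T`.
    let θ : T' → Module.Dual k (Module.Dual k T) := fun x' =>
      { toFun := fun φ => ξ (E s₀ φ x')
        map_add' := fun φ φ' => by rw [hEa2, LinearMap.add_apply, map_add]
        map_smul' := fun c φ => by rw [hEs2, LinearMap.smul_apply, map_smul]; rfl }
    have hg : ∀ x' (φ : Module.Dual k T), φ ((Module.evalEquiv k T).symm (θ x')) =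
        ξ (E s₀ φ x') := by
      intro x' φ
      have : Module.evalEquiv k T ((Module.evalEquiv k T).symm (θ x')) φ = θ x' φ := by
        rw [LinearEquiv.apply_symm_apply]
      exact this
    have hsep : ∀ y y' : T, (∀ φ : Module.Dual k T, φ y = φ y') → y = y' := fun y y' h =>
      (Module.evalEquiv k T).injective (LinearMap.ext h)
    let f : T' →ₗ[H] T :=
      { toFun := fun x' => (Module.evalEquiv k T).symm (θ x')
        map_add' := fun x' x'' => hsep _ _ fun φ => by
          rw [map_add φ, hg, hg, hg, map_add, map_add]
        map_smul' := fun h x' => hsep _ _ fun φ => by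
          rw [hg, ← hE2]
          exact (hg x' (φ ∘ₗ Algebra.lsmul k k T h)).symm }
    have hf : f ≠ 0 := by
      intro h
      have h1 := hg x φ₀
      have h2 : (Module.evalEquiv k T).symm (θ x) = 0 := LinearMap.congr_fun h x
      rw [h2, map_zero] at h1
      exact hξ h1.symm
    exact ⟨LinearEquiv.ofBijective f (LinearMap.bijective_of_ne_zero hf)⟩

end Uniqueness

/-! ### Every simple bimodule has the form `S ⊗ T^*` -/

section Existence

/-- The vector space `Hom(Y, S)` for an `H`-bimodule `Y`, with the left action
`(h ξ)(y) = ξ(y h)`. -/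
def DomainHom (k Y S : Type*) [Field k] [AddCommGroup Y] [Module k Y] [AddCommGroup S]
    [Module k S] : Type _ := Y →ₗ[k] S

variable {Y S T : Type*} [AddCommGroup Y] [Module k Y] [Module (H ⊗[k] Hᵐᵒᵖ) Y]
  [IsScalarTower k (H ⊗[k] Hᵐᵒᵖ) Y]
  [AddCommGroup S] [Module k S] [Module H S] [AddCommGroup T] [Module k T] [Module H T]

instance : AddCommGroup (DomainHom k Y S) := inferInstanceAs (AddCommGroup (Y →ₗ[k] S))

instance : Module k (DomainHom k Y S) := inferInstanceAs (Module k (Y →ₗ[k] S))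

instance [FiniteDimensional k Y] [FiniteDimensional k S] : FiniteDimensional k (DomainHom k Y S) :=
  inferInstanceAs (FiniteDimensional k (Y →ₗ[k] S))

variable (k H Y) in
/-- The right action on a bimodule. -/
def rightMul : H →ₗ[k] Module.End k Y :=
  (Algebra.lsmul k k Y : H ⊗[k] Hᵐᵒᵖ →ₐ[k] Module.End k Y).toLinearMap ∘ₗ
    TensorProduct.mk k H Hᵐᵒᵖ 1 ∘ₗ (MulOpposite.opLinearEquiv k).toLinearMap

theorem rightMul_apply (h : H) (y : Y) :
    rightMul k H Y h y = (1 ⊗ₜ[k] MulOpposite.op h : H ⊗[k] Hᵐᵒᵖ) • y := rfl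

theorem rightMul_one : rightMul k H Y 1 = LinearMap.id := by
  ext y
  rw [rightMul_apply, MulOpposite.op_one, ← Algebra.TensorProduct.one_def, one_smul]; rfl

theorem rightMul_mul (h h' : H) :
    rightMul k H Y (h * h') = rightMul k H Y h' ∘ₗ rightMul k H Y h := by
  ext y
  simp [rightMul_apply, smul_smul]

instance : Module H (DomainHom k Y S) where
  smul h ξ := LinearMap.comp (R₁ := k) (show Y →ₗ[k] S from ξ) (rightMul k H Y h)
  one_smul ξ := by
    change LinearMap.comp (R₁ := k) (show Y →ₗ[k] S from ξ) (rightMul k H Y 1) = ξ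
    rw [rightMul_one]; rfl
  mul_smul h h' ξ := by
    change LinearMap.comp (R₁ := k) (show Y →ₗ[k] S from ξ) (rightMul k H Y (h * h')) = _
    rw [rightMul_mul]; rfl
  smul_zero h := LinearMap.zero_comp (rightMul k H Y h)
  smul_add h ξ ξ' := LinearMap.add_comp (rightMul k H Y h) (show Y →ₗ[k] S from ξ')
    (show Y →ₗ[k] S from ξ)
  add_smul h h' ξ := by
    change LinearMap.comp (R₁ := k) (show Y →ₗ[k] S from ξ) (rightMul k H Y (h + h')) = _
    rw [map_add, LinearMap.comp_add]; rfl
  zero_smul ξ := by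
    change LinearMap.comp (R₁ := k) (show Y →ₗ[k] S from ξ) (rightMul k H Y 0) = _
    rw [map_zero, LinearMap.comp_zero]; rfl

instance : IsScalarTower k H (DomainHom k Y S) where
  smul_assoc c h ξ := by
    change LinearMap.comp (R₁ := k) (show Y →ₗ[k] S from ξ) (rightMul k H Y (c • h)) = _
    rw [map_smul, LinearMap.comp_smul]; rfl

/-- Evaluation of an element of `Hom(Y, S)`. -/
def DomainHom.eval (ξ : DomainHom k Y S) : Y →ₗ[k] S := ξ

theorem DomainHom.eval_smul {S : Type*} [AddCommGroup S] [Module k S] (h : H)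
    (ξ : DomainHom k Y S) (y : Y) :
    (h • ξ).eval y = ξ.eval ((1 ⊗ₜ[k] MulOpposite.op h : H ⊗[k] Hᵐᵒᵖ) • y) := rfl

theorem DomainHom.eval_add (ξ ξ' : DomainHom k Y S) (y : Y) :
    (ξ + ξ').eval y = ξ.eval y + ξ'.eval y := rfl

theorem tmul_op_eq (h h' : H) :
    (h ⊗ₜ[k] MulOpposite.op h' : H ⊗[k] Hᵐᵒᵖ) =
      (1 ⊗ₜ[k] MulOpposite.op h') * (h ⊗ₜ[k] 1) := by simp

theorem tmul_op_eq' (h h' : H) :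
    (h ⊗ₜ[k] MulOpposite.op h' : H ⊗[k] Hᵐᵒᵖ) =
      (h ⊗ₜ[k] 1) * (1 ⊗ₜ[k] MulOpposite.op h') := by simp

variable (k H Y S) in
/-- The submodule `Hom_H(Y, S)` of `Hom(Y, S)`. -/
def leftLinearHoms : Submodule H (DomainHom k Y S) where
  carrier := {ξ | ∀ (h : H) (y : Y), ξ.eval ((h ⊗ₜ[k] 1 : H ⊗[k] Hᵐᵒᵖ) • y) = h • ξ.eval y}
  zero_mem' h y := (smul_zero h).symm
  add_mem' {ξ ξ'} hξ hξ' h y := by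
    rw [DomainHom.eval_add, DomainHom.eval_add, smul_add, hξ, hξ']
  smul_mem' h' ξ hξ h y := by
    rw [DomainHom.eval_smul, DomainHom.eval_smul, smul_smul, ← tmul_op_eq, tmul_op_eq', ← smul_smul,
      hξ]

theorem eval_tmul_smul {ξ : DomainHom k Y S} (hξ : ξ ∈ leftLinearHoms k H Y S) (h h' : H) (y : Y) :
    ξ.eval ((h ⊗ₜ[k] MulOpposite.op h' : H ⊗[k] Hᵐᵒᵖ) • y) = h • (h' • ξ).eval y := by
  rw [tmul_op_eq', ← smul_smul, hξ, DomainHom.eval_smul]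

/-- A simple submodule `T` of `Hom_H(Y, S)` gives a nonzero homomorphism `Y → S ⊗ T^*`, hence
an isomorphism if `Y` is simple. -/
theorem nonempty_equiv_outerBimodule_of_submodule [IsAlgClosed k] [IsScalarTower k H S]
    [IsScalarTower k H T] [FiniteDimensional k S] [FiniteDimensional k T] [IsSimpleModule H S] [IsSimpleModule H T]
    [IsSimpleModule (H ⊗[k] Hᵐᵒᵖ) Y]
    (N : Submodule H (DomainHom k Y S)) (hN : N ≤ leftLinearHoms k H Y S) (e : N ≃ₗ[H] T) :
    Nonempty (Y ≃ₗ[H ⊗[k] Hᵐᵒᵖ] OuterBimodule k S T) := by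
  -- Elements of `T` are regarded through `e` as left-linear maps `Y → S`; `g` is the evaluation
  -- pairing read as a function of `y`.
  let g : Y → (T →ₗ[k] S) := fun y =>
    { toFun := fun x => (e.symm x).1.eval y
      map_add' := fun x x' => by rw [map_add]; rfl
      map_smul' := fun c x => by
        rw [← algebraMap_smul H c x, map_smul]
        change ((algebraMap k H c) • (e.symm x).1).eval y = _
        rw [algebraMap_smul]; rfl }
  have hgs : ∀ (h h' : H) (y : Y) (x : T), g ((h ⊗ₜ[k] MulOpposite.op h' : H ⊗[k] Hᵐᵒᵖ) • y) x =
      h • g y (h' • x) := by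
    intro h h' y x
    change (e.symm x).1.eval _ = h • (e.symm (h' • x)).1.eval y
    rw [eval_tmul_smul (hN (e.symm x).2), map_smul]; rfl
  have hga : ∀ y y', g (y + y') = g y + g y' := by
    intro y y'; ext x; exact map_add (e.symm x).1.eval y y'
  let f : Y →ₗ[H ⊗[k] Hᵐᵒᵖ] OuterBimodule k S T :=
    { toFun := fun y => (outerHomEquiv S T).symm (g y)
      map_add' := fun y y' => by rw [hga, map_add]
      map_smul' := fun a y => by
        apply (outerHomEquiv S T).injective
        rw [LinearEquiv.apply_symm_apply, RingHom.id_apply]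
        induction a with
        | zero =>
          have h0 : g 0 = 0 := by ext x; exact map_zero (e.symm x).1.eval
          have h1 := congrArg (outerHomEquiv S T)
            (zero_smul (H ⊗[k] Hᵐᵒᵖ) ((outerHomEquiv S T).symm (g y)))
          rw [zero_smul (H ⊗[k] Hᵐᵒᵖ) y, h0]
          exact (h1.trans (map_zero _)).symm
        | add a b ha hb => rw [add_smul, add_smul, hga, map_add, ha, hb]
        | tmul h h' =>
          ext x
          induction h' using MulOpposite.rec' with
          | h h' => rw [hgs, outerHomEquiv_smul, LinearEquiv.apply_symm_apply] }
  -- If `f` vanished, the map `Y → S` attached to a nonzero `x` would be zero at every `y`,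
  -- contradicting injectivity of `e.symm`. Then `f` is injective because `Y` is simple, and
  -- surjective because any nonzero value generates the target.
  have hf : f ≠ 0 := by
    intro h0
    have : Nontrivial T := IsSimpleModule.nontrivial H T
    obtain ⟨x, hx⟩ := exists_ne (0 : T)
    apply hx
    apply e.symm.injective
    rw [map_zero]
    apply Subtype.ext
    refine LinearMap.ext fun y => ?_
    have h1 : (outerHomEquiv S T).symm (g y) = 0 := LinearMap.congr_fun h0 y
    rw [LinearEquiv.map_eq_zero_iff] at h1
    exact LinearMap.congr_fun h1 x
  have hinj : Function.Injective f := LinearMap.injective_of_ne_zero hf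
  refine ⟨LinearEquiv.ofBijective f ⟨hinj, fun w => ?_⟩⟩
  obtain ⟨y, hy⟩ : ∃ y, f y ≠ 0 := by
    by_contra! h
    exact hf (LinearMap.ext h)
  obtain ⟨a, ha⟩ := exists_smul_eq_of_ne_zero (H := H) S T hy w
  exact ⟨a • y, by rw [map_smul, ha]⟩

end Existence

/-- The simple `H`-bimodules are the `S ⊗ T^*` with `S` and `T` simple `H`-modules. -/
theorem exists_nonempty_equiv_outerBimodule {k H : Type u} [Field k] [IsAlgClosed k]
    [Ring H] [HopfAlgebra k H] [FiniteDimensional k H]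
    {ι : Type*} (S : ι → Type u) [∀ i, AddCommGroup (S i)] [∀ i, Module k (S i)]
    [∀ i, Module H (S i)] [∀ i, IsScalarTower k H (S i)]
    (hsimple : ∀ i, IsSimpleModule H (S i))
    (hfull : ∀ (M : Type u) [AddCommGroup M] [Module H M], IsSimpleModule H M →
      ∃ i, Nonempty (M ≃ₗ[H] S i))
    (Y : Type u) [AddCommGroup Y] [Module k Y] [FiniteDimensional k Y]
    [Module (H ⊗[k] Hᵐᵒᵖ) Y] [IsScalarTower k (H ⊗[k] Hᵐᵒᵖ) Y]
    [IsSimpleModule (H ⊗[k] Hᵐᵒᵖ) Y] :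
    ∃ i j, Nonempty (Y ≃ₗ[H ⊗[k] Hᵐᵒᵖ] OuterBimodule k (S i) (S j)) := by
  have hfin : ∀ i, FiniteDimensional k (S i) := fun i =>
    finiteDimensional_of_isSimpleModule k H (S i)
  -- As a left `H`-module `Y` has a maximal submodule; the simple quotient is some `S i`, and the
  -- projection is a nonzero element of `Hom_H(Y, S i)`.
  obtain ⟨i, hi⟩ : ∃ i, leftLinearHoms k H Y (S i) ≠ ⊥ := by
    let : Module H Y := Module.compHom Y
      (Algebra.TensorProduct.includeLeft : H →ₐ[k] H ⊗[k] Hᵐᵒᵖ).toRingHom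
    have hsm : ∀ (h : H) (y : Y), h • y = (h ⊗ₜ[k] 1 : H ⊗[k] Hᵐᵒᵖ) • y := fun h y => rfl
    have : IsScalarTower k H Y := ⟨fun c h y => by
      rw [hsm, hsm, ← TensorProduct.smul_tmul', smul_assoc]⟩
    have : IsNoetherian H Y := isNoetherian_of_tower k inferInstance
    have : Nontrivial Y := IsSimpleModule.nontrivial (H ⊗[k] Hᵐᵒᵖ) Y
    obtain ⟨m, hm, -⟩ := (eq_top_or_exists_le_coatom (⊥ : Submodule H Y)).resolve_left bot_ne_top
    have hms : IsSimpleModule H (Y ⧸ m) := isSimpleModule_iff_isCoatom.mpr hm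
    obtain ⟨i, ⟨e⟩⟩ := hfull (Y ⧸ m) hms
    refine ⟨i, fun h0 => ?_⟩
    let ξ : Y →ₗ[H] S i := e.toLinearMap ∘ₗ m.mkQ
    have hξ : (show DomainHom k Y (S i) from ξ.restrictScalars k) ∈ leftLinearHoms k H Y (S i) :=
      fun h y => map_smul ξ h y
    rw [h0, Submodule.mem_bot] at hξ
    have hz : ∀ y, ξ y = 0 := fun y => LinearMap.congr_fun hξ y
    have hsurj : Function.Surjective ξ := e.surjective.comp m.mkQ_surjective
    have : Nontrivial (S i) := IsSimpleModule.nontrivial H (S i)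
    obtain ⟨x, hx⟩ := exists_ne (0 : S i)
    obtain ⟨y, hy⟩ := hsurj x
    exact hx (hy ▸ hz y)
  have : IsArtinian k (DomainHom k Y (S i)) :=
    inferInstanceAs (IsArtinian k (Y →ₗ[k] S i))
  have : IsArtinian H (DomainHom k Y (S i)) := isArtinian_of_tower k inferInstance
  -- The right action on `Y` makes `Hom_H(Y, S i)` an artinian `H`-module; being nonzero, it
  -- contains a simple submodule, isomorphic to some `S j`.
  obtain ⟨N, hN, hle⟩ := (eq_bot_or_exists_atom_le (leftLinearHoms k H Y (S i))).resolve_left hi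
  have hNs : IsSimpleModule H N := isSimpleModule_iff_isAtom.mpr hN
  obtain ⟨j, ⟨e⟩⟩ := hfull N hNs
  exact ⟨i, j, nonempty_equiv_outerBimodule_of_submodule N hle e⟩

end SimpleBimodules

end

end BulkCharacter

/-! ### The decomposition of the bulk character -/

theorem mainTheorem2 {k H : Type u} [Field k] [IsAlgClosed k] [CharZero k]
    [Ring H] [HopfAlgebra k H] [FiniteDimensional k H]
    (D : BulkCharacter.FactorizableRibbon k H)
    {ι : Type*} [Fintype ι] (S : ι → Type u) [∀ i, AddCommGroup (S i)] [∀ i, Module k (S i)]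
    [∀ i, Module H (S i)] [∀ i, IsScalarTower k H (S i)]
    (hsimple : ∀ i, IsSimpleModule H (S i))
    (hinj : ∀ i j, Nonempty (S i ≃ₗ[H] S j) → i = j)
    (hfull : ∀ (M : Type u) [AddCommGroup M] [Module H M], IsSimpleModule H M →
      ∃ i, Nonempty (M ≃ₗ[H] S i))
    (X : Type u) [AddCommGroup X] [Module k X] [FiniteDimensional k X]
    [Module (H ⊗[k] Hᵐᵒᵖ) X] [IsScalarTower k (H ⊗[k] Hᵐᵒᵖ) X] :
    BulkCharacter.bulkCharacter D.toRibbon X =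
      ∑ i, ∑ j,
        BulkCharacter.jhMultiplicity (H ⊗[k] Hᵐᵒᵖ) X (BulkCharacter.OuterBimodule k (S i) (S j)) •
          (LinearMap.mul' k k ∘ₗ TensorProduct.map
            (BulkCharacter.chiralDualCharacter (S i) D.toRibbon)
            (BulkCharacter.chiralCharacter (S j) D.toRibbon)) := by
  have hfin : ∀ i, FiniteDimensional k (S i) := fun i =>
    BulkCharacter.finiteDimensional_of_isSimpleModule k H (S i)
  have hinj' : ∀ p q : ι × ι, Nonempty (BulkCharacter.OuterBimodule k (S p.1) (S p.2)
      ≃ₗ[H ⊗[k] Hᵐᵒᵖ] BulkCharacter.OuterBimodule k (S q.1) (S q.2)) → p = q := by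
    rintro p q ⟨e⟩
    obtain ⟨h1, h2⟩ := BulkCharacter.nonempty_equiv_of_outerBimodule_equiv e
    exact Prod.ext (hinj _ _ h1) (hinj _ _ h2).symm
  have hclass : ∀ (Z : Type u) [AddCommGroup Z] [Module k Z] [Module (H ⊗[k] Hᵐᵒᵖ) Z]
      [IsScalarTower k (H ⊗[k] Hᵐᵒᵖ) Z] [FiniteDimensional k Z],
      IsSimpleModule (H ⊗[k] Hᵐᵒᵖ) Z → ∃ p : ι × ι, Nonempty (Z ≃ₗ[H ⊗[k] Hᵐᵒᵖ]
        BulkCharacter.OuterBimodule k (S p.1) (S p.2)) := by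
    intro Z _ _ _ _ _ _
    obtain ⟨i, j, h⟩ :=
      BulkCharacter.exists_nonempty_equiv_outerBimodule (k := k) S hsimple hfull Z
    exact ⟨(i, j), h⟩
  ext f g
  rw [TensorProduct.AlgebraTensorModule.curry_apply, LinearMap.restrictScalars_self,
    TensorProduct.curry_apply, BulkCharacter.bulkCharacter_tmul,
    BulkCharacter.moduleTrace_eq_sum_jhMultiplicity X
      (fun p : ι × ι => BulkCharacter.OuterBimodule k (S p.1) (S p.2)) hinj'
      hclass,
    Fintype.sum_prod_type]
  simp only [TensorProduct.AlgebraTensorModule.curry_apply, LinearMap.restrictScalars_self,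
    TensorProduct.curry_apply, LinearMap.sum_apply, LinearMap.smul_apply, LinearMap.comp_apply,
    TensorProduct.map_tmul, LinearMap.mul'_apply, BulkCharacter.chiralDualCharacter_apply,
    BulkCharacter.chiralCharacter_apply, BulkCharacter.moduleTrace_outerBimodule]
  refine Finset.sum_congr rfl fun i _ => Finset.sum_congr rfl fun j _ => ?_
  -- Multiplication in `H^op` has left `t` on the right of the slice of `Q`; cyclicity of the trace
  -- over `S j` restores the order in the chiral character.
  rw [BulkCharacter.moduleTrace_mul_comm (S j)]
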